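/- Let $b_1,b_2>0$ and $0<x_2<1$. Let $a$ be the $1$-periodic function with $a=b_2^{-2}$ on $[0,x_2)$ and $a=b_1^{-2}$ on $[x_2,1)$. For $k\ge 1$ let $a_k=a$ on $[0,k]$ and $a_k=b_1^{-2}$ outside $[0,k]$, and let $P_k=-\partial_x a_k\partial_x$ on $L^2(\mathbb R)$ with domain $\{u\in H^1(\mathbb R): a_k\partial_x u\in H^1(\mathbb R)\}$. For $\operatorname{Im}\lambda>0$ let $R_k(\lambda)=(P_k-\lambda^2)^{-1}$. As a function with values in the operators $L^2_{\rm comp}(\mathbb R)\to L^2_{\rm loc}(\mathbb R)$ (that is, after multiplication on both sides by the indicator function of any interval $[-N,N]$, in operator norm), $R_k$ has a meromorphic continuation to $\lambda\in\mathbb C$; let $\mathrm{Res}(P_k)$ be the set of its poles in $\mathbb C_-=\{\operatorname{Im}\lambda<0\}$. With $\rho=\frac{b_1^2+b_2^2}{2b_1b_2}$ put, for $\lambda\in\mathbb R$, $$F(\lambda)=\tfrac{\rho+1}{2}\cos\{\lambda(x_2b_2+(1-x_2)b_1)\}-\tfrac{\rho-1}{2}\cos\{\lambda(x_2b_2-(1-x_2)b_1)\}.$$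 The bands of the periodic operator $P=-\partial_x a\partial_x$ are the connected components of $\{\lambda\in\mathbb R:|F(\lambda)|^2<1\}$, and a degenerate band edge is a solution of $F=\pm1$ that is a boundary point of two different bands. Then the following hold. (2) If $b_2x_2=b_1(1-x_2)$, then for every $m\in\mathbb Z$ the point $\lambda_0=\pi m/(x_2b_2)$ is a degenerate band edge, and for every $k\ge1$ the set $\mathrm{Res}(P_k)$ is invariant under translation by the real number $T=\pi/(b_2x_2)$: $\lambda\in\mathrm{Res}(P_k)$ if and only if $\lambda+T\in\mathrm{Res}(P_k)$. (3) As $k\to\infty$ the set $\mathrm{Res}(P_k)$ approaches the real axis: for every $\varepsilon>0$ there is $K$ such that $|\operatorname{Im}\lambda|<\varepsilon$ for all $k\ge K$ and all $\lambda\in\mathrm{Res}(P_k)$. -/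

import Mathlib

open MeasureTheory Set Filter Topology
open scoped ContDiff

noncomputable section

namespace LayeredResonances

/-- The complex Hilbert space `L²(ℝ)`. -/
abbrev L2R : Type := Lp ℂ 2 (volume : Measure ℝ)

/-- The two-layer unit cell: `b₂⁻²` on `[0, x₂)` and `b₁⁻²` on `[x₂, 1)`. -/
def cellCoeff (b₁ b₂ x₂ : ℝ) (x : ℝ) : ℝ :=
  if x < x₂ then (b₂ ^ 2)⁻¹ else (b₁ ^ 2)⁻¹

/-- The `1`-periodic extension `a` of the unit cell. -/
def periodicCoeff (b₁ b₂ x₂ : ℝ) (x : ℝ) : ℝ :=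
  cellCoeff b₁ b₂ x₂ (Int.fract x)

open Classical in
/-- The locally periodic coefficient `a_k`: equal to `a` on `[0, k]` (that is, `k` identical cells)
and to `b₁⁻²` outside. -/
def truncatedCoeff (b₁ b₂ x₂ : ℝ) (k : ℕ) (x : ℝ) : ℝ :=
  if x ∈ Icc (0 : ℝ) k then periodicCoeff b₁ b₂ x₂ x else (b₁ ^ 2)⁻¹

/-- `w ∈ L²(ℝ)` is the weak derivative of `u ∈ L²(ℝ)`; in particular `u ∈ H¹(ℝ)`. -/
def HasWeakDeriv (u w : L2R) : Prop :=
  ∀ φ : ℝ → ℂ, ContDiff ℝ ∞ φ → HasCompactSupport φ →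
    ∫ x, u x * deriv φ x = - ∫ x, w x * φ x

/-- The graph of the operator `P = -∂ₓ a ∂ₓ` on `L²(ℝ)` with domain
`{u ∈ H¹(ℝ) : a ∂ₓ u ∈ H¹(ℝ)}`: `u` lies in the domain and `P u = f`. -/
def OperatorGraph (a : ℝ → ℝ) (u f : L2R) : Prop :=
  ∃ w q : L2R, HasWeakDeriv u w ∧ (∀ᵐ x : ℝ, q x = (a x : ℂ) * w x) ∧ HasWeakDeriv q (-f)

/-- `R = (P - lam²)⁻¹`, a bounded operator defined on all of `L²(ℝ)`: `u` lies in the domain of `P`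
and `(P - lam²) u = v` if and only if `u = R v`. -/
def IsResolventAt (a : ℝ → ℝ) (lam : ℂ) (R : L2R →L[ℂ] L2R) : Prop :=
  ∀ u v : L2R, OperatorGraph a u (lam ^ 2 • u + v) ↔ u = R v

/-- The product `1_{[-N, N]} f` for `f ∈ L²(ℝ)`. -/
def cutoffFun (N : ℕ) (f : L2R) : L2R :=
  MemLp.toLp ((Icc (-(N : ℝ)) (N : ℝ)).indicator f) ((Lp.memLp f).indicator measurableSet_Icc)

theorem cutoffFun_ae (N : ℕ) (f : L2R) :
    ∀ᵐ x : ℝ, cutoffFun N f x = (Icc (-(N : ℝ)) (N : ℝ)).indicator f x :=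
  MemLp.coeFn_toLp _

theorem cutoffFun_add (N : ℕ) (f g : L2R) :
    cutoffFun N (f + g) = cutoffFun N f + cutoffFun N g := by
  refine Lp.ext ?_
  filter_upwards [cutoffFun_ae N (f + g), cutoffFun_ae N f, cutoffFun_ae N g, Lp.coeFn_add f g,
    Lp.coeFn_add (cutoffFun N f) (cutoffFun N g)] with x h1 h2 h3 h4 h5
  rw [h1, h5, Pi.add_apply, h2, h3]
  by_cases hx : x ∈ Icc (-(N : ℝ)) (N : ℝ)
  · simp only [indicator_of_mem hx, h4, Pi.add_apply]
  · simp only [indicator_of_notMem hx, add_zero]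

theorem cutoffFun_smul (N : ℕ) (c : ℂ) (f : L2R) :
    cutoffFun N (c • f) = c • cutoffFun N f := by
  refine Lp.ext ?_
  filter_upwards [cutoffFun_ae N (c • f), cutoffFun_ae N f, Lp.coeFn_smul c f,
    Lp.coeFn_smul c (cutoffFun N f)] with x h1 h2 h3 h4
  rw [h1, h4, Pi.smul_apply, h2]
  by_cases hx : x ∈ Icc (-(N : ℝ)) (N : ℝ)
  · simp only [indicator_of_mem hx, h3, Pi.smul_apply]
  · simp only [indicator_of_notMem hx, smul_zero]

theorem norm_cutoffFun_le (N : ℕ) (f : L2R) : ‖cutoffFun N f‖ ≤ 1 * ‖f‖ := by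
  rw [one_mul]
  refine Lp.norm_le_norm_of_ae_le ?_
  filter_upwards [cutoffFun_ae N f] with x h1
  rw [h1]
  exact norm_indicator_le_norm_self _ _

/-- Multiplication by the indicator function of `[-N, N]`, as a bounded operator on `L²(ℝ)`. -/
def cutoff (N : ℕ) : L2R →L[ℂ] L2R :=
  LinearMap.mkContinuous
    { toFun := cutoffFun N
      map_add' := cutoffFun_add N
      map_smul' := cutoffFun_smul N }
    1 (norm_cutoffFun_le N)

/-- `T` is the meromorphic continuation to `ℂ` of the operator-valued function
`lam ↦ 1_{[-N,N]} (P - lam²)⁻¹ 1_{[-N,N]}`, given for `Im lam > 0`. A meromorphic continuation of the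
resolvent as a map `L²_comp(ℝ) → L²_loc(ℝ)` is a compatible family of these for `N = 1, 2, …`. -/
def IsContinuedResolvent (a : ℝ → ℝ) (N : ℕ) (T : ℂ → (L2R →L[ℂ] L2R)) : Prop :=
  Meromorphic T ∧
    ∀ lam : ℂ, 0 < lam.im → ∃ R : L2R →L[ℂ] L2R,
      IsResolventAt a lam R ∧ T lam = cutoff N ∘L R ∘L cutoff N

/-- The resonances of `-∂ₓ a ∂ₓ`: the poles in the open lower half plane of the meromorphic
continuation of the resolvent `L²_comp(ℝ) → L²_loc(ℝ)`. -/
def Res (a : ℝ → ℝ) : Set ℂ :=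
  {lam | lam.im < 0 ∧ ∃ (N : ℕ) (T : ℂ → (L2R →L[ℂ] L2R)),
    IsContinuedResolvent a N T ∧ meromorphicOrderAt T lam < 0}

/-- The number `ρ = (b₁² + b₂²) / (2 b₁ b₂)`. -/
def rho (b₁ b₂ : ℝ) : ℝ := (b₁ ^ 2 + b₂ ^ 2) / (2 * b₁ * b₂)

/-- The Lyapunov function of the periodic operator `-∂ₓ a ∂ₓ` on the real frequency axis. -/
def lyapunov (b₁ b₂ x₂ : ℝ) (lam : ℝ) : ℝ :=
  (rho b₁ b₂ + 1) / 2 * Real.cos (lam * (x₂ * b₂ + (1 - x₂) * b₁))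
    - (rho b₁ b₂ - 1) / 2 * Real.cos (lam * (x₂ * b₂ - (1 - x₂) * b₁))

/-- The allowed zones on the frequency axis. -/
def bandSpectrum (b₁ b₂ x₂ : ℝ) : Set ℝ :=
  {lam | |lyapunov b₁ b₂ x₂ lam| ^ 2 < 1}

/-- A band (allowed zone) is a connected component of `bandSpectrum`. -/
def IsBand (b₁ b₂ x₂ : ℝ) (J : Set ℝ) : Prop :=
  ∃ lam ∈ bandSpectrum b₁ b₂ x₂, J = connectedComponentIn (bandSpectrum b₁ b₂ x₂) lam

/-- A degenerate band edge: a solution of `F = ±1` that is a boundary point of two different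
bands. -/
def IsDegenerateBandEdge (b₁ b₂ x₂ : ℝ) (lam₀ : ℝ) : Prop :=
  (lyapunov b₁ b₂ x₂ lam₀ = 1 ∨ lyapunov b₁ b₂ x₂ lam₀ = -1) ∧
    ∃ J₁ J₂ : Set ℝ, IsBand b₁ b₂ x₂ J₁ ∧ IsBand b₁ b₂ x₂ J₂ ∧ J₁ ≠ J₂ ∧
      lam₀ ∈ frontier J₁ ∧ lam₀ ∈ frontier J₂

end LayeredResonances

end

open MeasureTheory Set Filter Topology
open scoped ContDiff

noncomputable section

namespace LayeredResonances

open Complex (I)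
open scoped NNReal ENNReal

/-! ### Transfer maps and the fundamental solution

The equation `-(a u')' = lam² u` is written as the first order system
`u' = i lam a⁻¹ v`, `v' = i lam u` for the pair `(u, v)` with `v = a u' / (i lam)`. -/

/-! Writing `-(a u')' = lam² u` as a first order system for `(u, v)` turns each homogeneous layer
into a determinant-one linear map, entire in `lam` (`layer`), under which the amplitudes `u ± b v`
of the right- and left-going waves are multiplied by `exp (± i θ)`. A unit cell is a product of two
such maps (`cell`), and `k` cells are its `k`-th power.

Let `D(lam)` be the Wronskian `jostDet` of the two Jost solutions, which are outgoing to the left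
and to the right respectively. For `Im lam > 0` the resolvent is `i / (lam D(lam))` times the
integral operator with kernel `u₋(min) u₊(max)` (`exists_isResolventAt`). Cut off to `[-N, N]`, that
operator is entire in `lam` (`exists_differentiable_cutKernel`), which gives the continuation; for
`N = k + 1` it is never zero (`exists_cutKernel_ne_zero`), so no zero of `D` is cancelled. Hence the
resonances are exactly the zeros of `D` in the lower half plane (`mem_Res_iff`), and both claims
about resonances become claims about powers of the cell map.

If `b₂ x₂ = b₁ (1 - x₂)`, both layers have the same phase. Then `F = 1 - (ρ + 1) sin²`, which
touches `1` from below at each zero of the sine, so two bands meet there. Translating `lam` by `π /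
(b₂ x₂)` adds `π` to both phases; each layer map changes sign, the signs cancel, and the cell map,
hence `D`, is unchanged (`cell_add_period`).

For the approach to the real axis, suppose `Im lam ≤ -ε`. In the basis of wave amplitudes the cell
is a matrix `(A B; C E)` of determinant one, and `D = 0` says that a purely left-going state has no
left-going component after `k` cells. With a Floquet multiplier `μ`, `‖μ‖ ≥ 1`, the closed form of
the powers turns this into `κ ‖μ‖^k ≤ κ + 2 ‖μ‖`, where `κ² = ‖B C‖`
(`mul_norm_pow_le_of_recurrence_eq_zero`). Here `κ` is the impedance contrast times `‖sin (lam b₂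
x₂)‖`, which is at least a fixed multiple of `ε`, while growth of the energy flux in the lower half
plane forces `‖μ‖ ≥ exp (ε b₂ x₂)`. Both bounds are uniform in `Re lam`, so `k` is bounded. Without
contrast the matrix is triangular and `D` never vanishes. -/

/-- The transfer map of a homogeneous layer `a = b⁻²` of optical thickness `θ = lam b ℓ`. -/
def layer (b : ℝ) (θ : ℂ) (w : ℂ × ℂ) : ℂ × ℂ :=
  (Complex.cos θ * w.1 + I * b * Complex.sin θ * w.2,
    I / b * Complex.sin θ * w.1 + Complex.cos θ * w.2)

/-- The Wronskian of two states. -/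
def wronskian (w z : ℂ × ℂ) : ℂ := w.1 * z.2 - z.1 * w.2

theorem layer_zero (b : ℝ) (w : ℂ × ℂ) : layer b 0 w = w := by
  simp [layer]

theorem layer_layer {b : ℝ} (hb : b ≠ 0) (θ θ' : ℂ) (w : ℂ × ℂ) :
    layer b θ (layer b θ' w) = layer b (θ + θ') w := by
  have hb' : (b : ℂ) ≠ 0 := by exact_mod_cast hb
  have hI := Complex.I_mul_I
  ext
  · simp only [layer, Complex.cos_add, Complex.sin_add]
    field_simp
    linear_combination (Complex.sin θ * Complex.sin θ' * w.1) * hI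
  · simp only [layer, Complex.cos_add, Complex.sin_add]
    field_simp
    linear_combination (Complex.sin θ * Complex.sin θ' * w.2 * b) * hI

theorem wronskian_layer {b : ℝ} (hb : b ≠ 0) (θ : ℂ) (w z : ℂ × ℂ) :
    wronskian (layer b θ w) (layer b θ z) = wronskian w z := by
  have hb' : (b : ℂ) ≠ 0 := by exact_mod_cast hb
  have hI := Complex.I_mul_I
  have h := Complex.sin_sq_add_cos_sq θ
  simp only [layer, wronskian]
  field_simp
  linear_combination (w.1 * z.2 - w.2 * z.1) * b * h -
    Complex.sin θ ^ 2 * (w.1 * z.2 - w.2 * z.1) * b * hI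

/-- In a homogeneous layer the wave amplitudes are multiplied by `exp (± i θ)`. -/
theorem layer_add_mul {b : ℝ} (hb : b ≠ 0) (θ : ℂ) (w : ℂ × ℂ) :
    (layer b θ w).1 + b * (layer b θ w).2 = Complex.exp (θ * I) * (w.1 + b * w.2) := by
  have hb' : (b : ℂ) ≠ 0 := by exact_mod_cast hb
  rw [Complex.exp_mul_I]
  simp only [layer]
  field_simp
  ring

theorem layer_sub_mul {b : ℝ} (hb : b ≠ 0) (θ : ℂ) (w : ℂ × ℂ) :
    (layer b θ w).1 - b * (layer b θ w).2 = Complex.exp (-θ * I) * (w.1 - b * w.2) := by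
  have hb' : (b : ℂ) ≠ 0 := by exact_mod_cast hb
  rw [Complex.exp_mul_I, Complex.cos_neg, Complex.sin_neg]
  simp only [layer]
  field_simp
  ring

theorem continuous_layer {X : Type*} [TopologicalSpace X] (b : ℝ) {θ : X → ℂ} {w : X → ℂ × ℂ}
    (hθ : Continuous θ) (hw : Continuous w) : Continuous fun p ↦ layer b (θ p) (w p) := by
  unfold layer
  fun_prop

theorem differentiable_layer (b : ℝ) {θ : ℂ → ℂ} {w : ℂ → ℂ × ℂ} (hθ : Differentiable ℂ θ)
    (hw : Differentiable ℂ w) : Differentiable ℂ fun lam ↦ layer b (θ lam) (w lam) := by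
  unfold layer
  fun_prop

theorem hasDerivAt_layer {b : ℝ} (hb : b ≠ 0) (lam : ℂ) (w : ℂ × ℂ) (x : ℝ) :
    HasDerivAt (fun y : ℝ ↦ (layer b (lam * b * y) w).1)
      (I * lam * (((b ^ 2)⁻¹ : ℝ) : ℂ)⁻¹ * (layer b (lam * b * x) w).2) x ∧
    HasDerivAt (fun y : ℝ ↦ (layer b (lam * b * y) w).2)
      (I * lam * (layer b (lam * b * x) w).1) x := by
  have hb' : (b : ℂ) ≠ 0 := by exact_mod_cast hb
  have hI := Complex.I_mul_I
  have h0 : HasDerivAt (fun z : ℂ ↦ lam * b * z) (lam * b) (x : ℂ) := by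
    simpa using (hasDerivAt_id (x : ℂ)).const_mul (lam * b)
  have hs := h0.csin.comp_ofReal
  have hc := h0.ccos.comp_ofReal
  constructor
  · refine ((hc.mul_const w.1).add ((hs.const_mul (I * b)).mul_const w.2)).congr_deriv ?_
    simp only [layer]
    push_cast
    generalize Complex.sin (lam * b * x) = S
    field_simp
    linear_combination (-lam * S * w.1) * hI
  · refine (((hs.const_mul (I / b)).mul_const w.1).add (hc.mul_const w.2)).congr_deriv ?_
    simp only [layer]
    generalize Complex.sin (lam * b * x) = S
    field_simp
    linear_combination (-lam * b * S * w.2) * hI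

theorem norm_cos_le_exp (θ : ℂ) : ‖Complex.cos θ‖ ≤ Real.exp |θ.im| := by
  rw [Complex.cos, norm_div, Complex.norm_two, div_le_iff₀ two_pos]
  refine (norm_add_le _ _).trans ?_
  have h1 : ‖Complex.exp (θ * I)‖ ≤ Real.exp |θ.im| := by
    rw [Complex.norm_exp]
    exact Real.exp_le_exp.2 (by simpa using neg_le_abs θ.im)
  have h2 : ‖Complex.exp (-θ * I)‖ ≤ Real.exp |θ.im| := by
    rw [Complex.norm_exp]
    exact Real.exp_le_exp.2 (by simpa using le_abs_self θ.im)
  linarith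

theorem norm_sin_le_exp (θ : ℂ) : ‖Complex.sin θ‖ ≤ Real.exp |θ.im| := by
  rw [Complex.sin, norm_div, Complex.norm_two, div_le_iff₀ two_pos, norm_mul, Complex.norm_I,
    mul_one]
  refine (norm_sub_le _ _).trans ?_
  have h1 : ‖Complex.exp (θ * I)‖ ≤ Real.exp |θ.im| := by
    rw [Complex.norm_exp]
    exact Real.exp_le_exp.2 (by simpa using neg_le_abs θ.im)
  have h2 : ‖Complex.exp (-θ * I)‖ ≤ Real.exp |θ.im| := by
    rw [Complex.norm_exp]
    exact Real.exp_le_exp.2 (by simpa using le_abs_self θ.im)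
  linarith

theorem norm_layer_le {b : ℝ} (hb : 0 < b) (θ : ℂ) (w : ℂ × ℂ) :
    ‖layer b θ w‖ ≤ (1 + b + b⁻¹) * ‖w‖ * Real.exp |θ.im| := by
  have h1 := norm_fst_le w
  have h2 := norm_snd_le w
  have hc := norm_cos_le_exp θ
  have hs := norm_sin_le_exp θ
  have hi : 0 < b⁻¹ := inv_pos.2 hb
  have hw := norm_nonneg w
  have he := (Real.exp_pos |θ.im|).le
  have hew : 0 ≤ ‖w‖ * Real.exp |θ.im| := by positivity
  have e1 : ‖Complex.cos θ‖ * ‖w.1‖ ≤ Real.exp |θ.im| * ‖w‖ := by gcongr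
  have e2 : ‖Complex.cos θ‖ * ‖w.2‖ ≤ Real.exp |θ.im| * ‖w‖ := by gcongr
  have e3 : b * ‖Complex.sin θ‖ * ‖w.2‖ ≤ b * Real.exp |θ.im| * ‖w‖ := by gcongr
  have e4 : b⁻¹ * ‖Complex.sin θ‖ * ‖w.1‖ ≤ b⁻¹ * Real.exp |θ.im| * ‖w‖ := by gcongr
  rw [Prod.norm_def]
  refine max_le ?_ ?_
  · refine (norm_add_le _ _).trans ?_
    simp only [norm_mul, Complex.norm_I, Complex.norm_real, Real.norm_eq_abs, abs_of_pos hb,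
      one_mul]
    nlinarith
  · refine (norm_add_le _ _).trans ?_
    simp only [norm_mul, norm_div, Complex.norm_I, Complex.norm_real, Real.norm_eq_abs,
      abs_of_pos hb, one_div]
    nlinarith

/-- The transfer map of a unit cell. -/
def cell (b₁ b₂ x₂ : ℝ) (lam : ℂ) (w : ℂ × ℂ) : ℂ × ℂ :=
  layer b₁ (lam * b₁ * (1 - x₂)) (layer b₂ (lam * b₂ * x₂) w)

/-- The inverse of `cell`. -/
def cellInv (b₁ b₂ x₂ : ℝ) (lam : ℂ) (w : ℂ × ℂ) : ℂ × ℂ :=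
  layer b₂ (-(lam * b₂ * x₂)) (layer b₁ (-(lam * b₁ * (1 - x₂))) w)

/-- The solution for `k` unit cells with state `w` at the origin. -/
def sol (b₁ b₂ x₂ : ℝ) : ℕ → ℂ → ℂ × ℂ → ℝ → ℂ × ℂ
  | 0, lam, w, x => layer b₁ (lam * b₁ * x) w
  | k + 1, lam, w, x =>
    if x ≤ x₂ then
      (if x ≤ 0 then layer b₁ (lam * b₁ * x) w else layer b₂ (lam * b₂ * x) w)
    -- The second layer of the first cell has the same coefficient `b₁⁻²` as the exterior. The
    -- remaining `k` cells, seen from their own origin, therefore already continue correctly to the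
    -- left into that layer, and no separate case is needed for it.
    else sol b₁ b₂ x₂ k lam (cell b₁ b₂ x₂ lam w) (x - 1)

section

variable {b₁ b₂ x₂ : ℝ}

theorem cell_cellInv (hb₁ : b₁ ≠ 0) (hb₂ : b₂ ≠ 0) (lam : ℂ) (w : ℂ × ℂ) :
    cell b₁ b₂ x₂ lam (cellInv b₁ b₂ x₂ lam w) = w := by
  simp [cell, cellInv, layer_layer hb₁, layer_layer hb₂, layer_zero]

theorem iterate_cell_iterate_cellInv (hb₁ : b₁ ≠ 0) (hb₂ : b₂ ≠ 0) (lam : ℂ) (k : ℕ)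
    (w : ℂ × ℂ) : (cell b₁ b₂ x₂ lam)^[k] ((cellInv b₁ b₂ x₂ lam)^[k] w) = w := by
  have h : Function.LeftInverse (cell b₁ b₂ x₂ lam) (cellInv b₁ b₂ x₂ lam) :=
    cell_cellInv hb₁ hb₂ lam
  exact h.iterate k w

theorem differentiable_iterate_cell {w : ℂ → ℂ × ℂ} (hw : Differentiable ℂ w) (k : ℕ) :
    Differentiable ℂ fun lam ↦ (cell b₁ b₂ x₂ lam)^[k] (w lam) := by
  induction k with
  | zero => simpa using hw
  | succ k ih =>
    simp only [Function.iterate_succ_apply']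
    exact differentiable_layer _ (by fun_prop) (differentiable_layer _ (by fun_prop) ih)

theorem differentiable_iterate_cellInv {w : ℂ → ℂ × ℂ} (hw : Differentiable ℂ w) (k : ℕ) :
    Differentiable ℂ fun lam ↦ (cellInv b₁ b₂ x₂ lam)^[k] (w lam) := by
  induction k with
  | zero => simpa using hw
  | succ k ih =>
    simp only [Function.iterate_succ_apply']
    exact differentiable_layer _ (by fun_prop) (differentiable_layer _ (by fun_prop) ih)

theorem sol_of_nonpos (hx₀ : 0 < x₂) (k : ℕ) (lam : ℂ) (w : ℂ × ℂ) {x : ℝ} (hx : x ≤ 0) :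
    sol b₁ b₂ x₂ k lam w x = layer b₁ (lam * b₁ * x) w := by
  cases k with
  | zero => rfl
  | succ k => simp [sol, hx, hx.trans hx₀.le]

theorem sol_of_ge (hx₁ : x₂ < 1) (k : ℕ) (lam : ℂ) (w : ℂ × ℂ) {x : ℝ} (hx : (k : ℝ) ≤ x) :
    sol b₁ b₂ x₂ k lam w x
      = layer b₁ (lam * b₁ * (x - k)) ((cell b₁ b₂ x₂ lam)^[k] w) := by
  induction k generalizing w x with
  | zero => simp [sol]
  | succ k ih =>
    push_cast at hx
    have hk : (0 : ℝ) ≤ k := k.cast_nonneg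
    rw [sol, if_neg (by linarith), ih _ (by linarith), Function.iterate_succ_apply]
    congr 1
    push_cast
    ring

theorem continuous_sol (hb₁ : b₁ ≠ 0) (hx₀ : 0 < x₂) (hx₁ : x₂ < 1) (k : ℕ) :
    Continuous fun p : ℂ × (ℂ × ℂ) × ℝ ↦ sol b₁ b₂ x₂ k p.1 p.2.1 p.2.2 := by
  have hl (b : ℝ) : Continuous fun p : ℂ × (ℂ × ℂ) × ℝ ↦ layer b (p.1 * b * p.2.2) p.2.1 :=
    continuous_layer b (by fun_prop) (by fun_prop)
  induction k with
  | zero => exact hl b₁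
  | succ k ih =>
    simp only [sol]
    refine Continuous.if_le (Continuous.if_le (hl b₁) (hl b₂) (by fun_prop) (by fun_prop) ?_) ?_
      (by fun_prop) (by fun_prop) ?_
    · rintro ⟨lam, w, x⟩ h
      simp only at h
      simp [h, layer_zero]
    · have hc : Continuous fun p : ℂ × (ℂ × ℂ) × ℝ ↦ cell b₁ b₂ x₂ p.1 p.2.1 :=
        continuous_layer _ (by fun_prop) (continuous_layer _ (by fun_prop) (by fun_prop))
      exact ih.comp (f := fun p : ℂ × (ℂ × ℂ) × ℝ ↦ (p.1, cell b₁ b₂ x₂ p.1 p.2.1, p.2.2 - 1))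
        (continuous_fst.prodMk (hc.prodMk (by fun_prop)))
    · rintro ⟨lam, w, x⟩ h
      simp only at h
      subst h
      rw [if_neg (not_le.2 hx₀), sol_of_nonpos hx₀ _ _ _ (by linarith), cell, layer_layer hb₁]
      push_cast
      rw [show lam * b₁ * (x - 1) + lam * b₁ * (1 - x) = 0 by ring, layer_zero]

theorem differentiable_sol (k : ℕ) {w : ℂ → ℂ × ℂ} (hw : Differentiable ℂ w) (x : ℝ) :
    Differentiable ℂ fun lam ↦ sol b₁ b₂ x₂ k lam (w lam) x := by
  induction k generalizing w x with
  | zero => exact differentiable_layer _ (by fun_prop) hw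
  | succ k ih =>
    simp only [sol]
    split_ifs
    · exact differentiable_layer _ (by fun_prop) hw
    · exact differentiable_layer _ (by fun_prop) hw
    · exact ih (differentiable_iterate_cell hw 1) (x - 1)

theorem wronskian_sol (hb₁ : b₁ ≠ 0) (hb₂ : b₂ ≠ 0) (k : ℕ) (lam : ℂ) (w z : ℂ × ℂ) (x : ℝ) :
    wronskian (sol b₁ b₂ x₂ k lam w x) (sol b₁ b₂ x₂ k lam z x) = wronskian w z := by
  induction k generalizing w z x with
  | zero => exact wronskian_layer hb₁ _ _ _
  | succ k ih =>
    simp only [sol]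
    split_ifs
    · exact wronskian_layer hb₁ _ _ _
    · exact wronskian_layer hb₂ _ _ _
    · rw [ih, cell, cell, wronskian_layer hb₁, wronskian_layer hb₂]

/-- The counterpart of the recursion in `sol`: peeling off the first cell leaves `k` cells shifted
by one, because the layer `[x₂, 1)` cannot be told apart from the exterior. -/
theorem truncatedCoeff_succ (hx₀ : 0 < x₂) (hx₁ : x₂ < 1) (k : ℕ) (x : ℝ) :
    truncatedCoeff b₁ b₂ x₂ (k + 1) x = if x < 0 then (b₁ ^ 2)⁻¹ else
      if x < x₂ then (b₂ ^ 2)⁻¹ else truncatedCoeff b₁ b₂ x₂ k (x - 1) := by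
  have hk : (0 : ℝ) ≤ k := k.cast_nonneg
  unfold truncatedCoeff
  rcases lt_or_ge x 0 with h0 | h0
  · rw [if_neg (by simp [h0]), if_pos h0]
  rw [if_neg (not_lt.2 h0)]
  have hp : periodicCoeff b₁ b₂ x₂ (x - 1) = periodicCoeff b₁ b₂ x₂ x := by
    rw [periodicCoeff, periodicCoeff, Int.fract_sub_one]
  rcases lt_or_ge x 1 with h1 | h1
  · have hf : Int.fract x = x := Int.fract_eq_self.2 ⟨h0, h1⟩
    rw [if_pos ⟨h0, by push_cast; linarith⟩, if_neg (c := x - 1 ∈ _) (by simp [h1]),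
      periodicCoeff, cellCoeff, hf]
  · rw [if_neg (c := x < x₂) (by linarith), hp]
    congr 1
    simp only [mem_Icc, Nat.cast_add, Nat.cast_one, eq_iff_iff]
    constructor <;> rintro ⟨-, h⟩ <;> constructor <;> linarith

/-- Off a countable set the coefficient is locally constant and `sol` solves the system. -/
theorem exists_countable_hasDerivAt_sol (hb₁ : b₁ ≠ 0) (hb₂ : b₂ ≠ 0) (hx₀ : 0 < x₂)
    (hx₁ : x₂ < 1) (k : ℕ) : ∃ s : Set ℝ, s.Countable ∧ ∀ x ∉ s,
      (∀ᶠ y in 𝓝 x, truncatedCoeff b₁ b₂ x₂ k y = truncatedCoeff b₁ b₂ x₂ k x) ∧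
      ∀ (lam : ℂ) (w : ℂ × ℂ),
        HasDerivAt (fun y ↦ (sol b₁ b₂ x₂ k lam w y).1)
          (I * lam * (truncatedCoeff b₁ b₂ x₂ k x : ℂ)⁻¹ * (sol b₁ b₂ x₂ k lam w x).2) x ∧
        HasDerivAt (fun y ↦ (sol b₁ b₂ x₂ k lam w y).2)
          (I * lam * (sol b₁ b₂ x₂ k lam w x).1) x := by
  induction k with
  | zero =>
    -- Even for `k = 0` the closed interval `[0, 0]` gives the coefficient the value `b₂⁻²` at the
    -- single point `0`, which has to be excluded.
    refine ⟨{0}, countable_singleton 0, fun x hx ↦ ?_⟩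
    have h (y : ℝ) (hy : y ∈ ({0} : Set ℝ)ᶜ) :
        truncatedCoeff b₁ b₂ x₂ 0 y = (b₁ ^ 2)⁻¹ := by
      rw [truncatedCoeff, if_neg (by simpa using hy)]
    have hn : ({0} : Set ℝ)ᶜ ∈ 𝓝 x := isOpen_compl_singleton.mem_nhds hx
    refine ⟨?_, fun lam w ↦ ?_⟩
    · filter_upwards [hn] with y hy
      rw [h y hy, h x hx]
    · rw [h x hx]
      exact hasDerivAt_layer hb₁ lam w x
  | succ k ih =>
    obtain ⟨s, hs, h⟩ := ih
    refine ⟨{0, x₂} ∪ (fun y ↦ y + 1) '' s, (by simp : ({0, x₂} : Set ℝ).Countable).union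
      (hs.image _), fun x hx ↦ ?_⟩
    simp only [mem_union, mem_insert_iff, mem_singleton_iff, not_or] at hx
    obtain ⟨⟨hx0, hx2⟩, hxs⟩ := hx
    simp only [truncatedCoeff_succ hx₀ hx₁]
    rcases lt_or_gt_of_ne hx0 with h0 | h0
    · have hn : Iio 0 ∈ 𝓝 x := isOpen_Iio.mem_nhds h0
      refine ⟨?_, fun lam w ↦ ?_⟩
      · filter_upwards [hn] with y hy
        rw [if_pos (mem_Iio.1 hy), if_pos h0]
      · have he : sol b₁ b₂ x₂ (k + 1) lam w =ᶠ[𝓝 x] fun y : ℝ ↦ layer b₁ (lam * b₁ * y) w := by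
          filter_upwards [hn] with y hy
          exact sol_of_nonpos hx₀ _ _ _ (le_of_lt hy)
        rw [if_pos h0, he.eq_of_nhds]
        obtain ⟨h1, h2⟩ := hasDerivAt_layer hb₁ lam w x
        exact ⟨h1.congr_of_eventuallyEq (he.fun_comp Prod.fst),
          h2.congr_of_eventuallyEq (he.fun_comp Prod.snd)⟩
    rcases lt_or_gt_of_ne hx2 with h2 | h2
    · have hn : Ioo 0 x₂ ∈ 𝓝 x := isOpen_Ioo.mem_nhds ⟨h0, h2⟩
      refine ⟨?_, fun lam w ↦ ?_⟩
      · filter_upwards [hn] with y hy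
        rw [if_neg (not_lt.2 hy.1.le), if_pos hy.2, if_neg (not_lt.2 h0.le), if_pos h2]
      · have he : sol b₁ b₂ x₂ (k + 1) lam w =ᶠ[𝓝 x] fun y : ℝ ↦ layer b₂ (lam * b₂ * y) w := by
          filter_upwards [hn] with y hy
          rw [sol, if_pos hy.2.le, if_neg (not_le.2 hy.1)]
        rw [if_neg (not_lt.2 h0.le), if_pos h2, he.eq_of_nhds]
        obtain ⟨h1, h2⟩ := hasDerivAt_layer hb₂ lam w x
        exact ⟨h1.congr_of_eventuallyEq (he.fun_comp Prod.fst),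
          h2.congr_of_eventuallyEq (he.fun_comp Prod.snd)⟩
    · have hn : Ioi x₂ ∈ 𝓝 x := isOpen_Ioi.mem_nhds h2
      obtain ⟨ha, hd⟩ := h (x - 1) (fun hm ↦ hxs ⟨x - 1, hm, by ring⟩)
      refine ⟨?_, fun lam w ↦ ?_⟩
      · have hc : Tendsto (fun y : ℝ ↦ y - 1) (𝓝 x) (𝓝 (x - 1)) :=
          (continuous_sub_right 1).tendsto x
        filter_upwards [hn, hc.eventually ha] with y hy hy'
        have hy2 : x₂ < y := hy
        rw [if_neg (by linarith), if_neg (by linarith), if_neg (by linarith),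
          if_neg (by linarith), hy']
      · have he : sol b₁ b₂ x₂ (k + 1) lam w =ᶠ[𝓝 x]
            fun y : ℝ ↦ sol b₁ b₂ x₂ k lam (cell b₁ b₂ x₂ lam w) (y - 1) := by
          filter_upwards [hn] with y hy
          rw [sol, if_neg (not_le.2 hy)]
        rw [if_neg (not_lt.2 h0.le), if_neg (not_lt.2 h2.le), he.eq_of_nhds]
        obtain ⟨h1, h2⟩ := hd lam (cell b₁ b₂ x₂ lam w)
        exact ⟨(h1.comp_sub_const x 1).congr_of_eventuallyEq (he.fun_comp Prod.fst),
          (h2.comp_sub_const x 1).congr_of_eventuallyEq (he.fun_comp Prod.snd)⟩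

end

/-! ### Integral operators on `L²(ℝ)` -/


/-- A measurable kernel whose rows and columns have `L¹` norm at most `A`. -/
structure IsSchurKernel (K : ℝ → ℝ → ℂ) (A : ℝ≥0) : Prop where
  measurable : Measurable (Function.uncurry K)
  lintegral_right_le : ∀ x, ∫⁻ y, ‖K x y‖ₑ ≤ A
  lintegral_left_le : ∀ y, ∫⁻ x, ‖K x y‖ₑ ≤ A

/-- `L` is the integral operator with kernel `K`. -/
def HasKernel (L : L2R →L[ℂ] L2R) (K : ℝ → ℝ → ℂ) : Prop :=
  ∀ f : L2R, ∀ᵐ x : ℝ, L f x = ∫ y, K x y * f y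

/-- Cauchy–Schwarz for the functions `1` and `g` with respect to the measure of density `k`; it is
the pointwise half of the Schur test. -/
theorem sq_lintegral_mul_le {α : Type*} [MeasurableSpace α] (μ : Measure α) {k g : α → ℝ≥0∞}
    (hk : Measurable k) (hg : Measurable g) :
    (∫⁻ y, k y * g y ∂μ) ^ 2 ≤ (∫⁻ y, k y ∂μ) * ∫⁻ y, k y * g y ^ 2 ∂μ := by
  have h := ENNReal.lintegral_mul_le_Lp_mul_Lq (μ.withDensity k)
    Real.HolderConjugate.two_two (f := fun _ ↦ 1) (g := g) aemeasurable_const hg.aemeasurable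
  have h2 : ((∫⁻ a, ((fun _ ↦ 1 : α → ℝ≥0∞) * g) a ∂μ.withDensity k)) ^ 2 ≤
      (∫⁻ _, 1 ∂μ.withDensity k) * ∫⁻ y, g y ^ 2 ∂μ.withDensity k := by
    refine (pow_le_pow_left' h 2).trans (le_of_eq ?_)
    rw [mul_pow, ← ENNReal.rpow_natCast, ← ENNReal.rpow_natCast, ← ENNReal.rpow_mul,
      ← ENNReal.rpow_mul]
    norm_num
  rw [lintegral_withDensity_eq_lintegral_mul _ hk (measurable_const.mul hg),
    lintegral_withDensity_eq_lintegral_mul _ hk measurable_const,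
    lintegral_withDensity_eq_lintegral_mul _ hk (hg.pow_const 2)] at h2
  simpa using h2

theorem eLpNorm_two_sq {f : ℝ → ℂ} :
    eLpNorm f 2 (volume : Measure ℝ) ^ 2 = ∫⁻ x, ‖f x‖ₑ ^ 2 := by
  have h := eLpNorm_nnreal_pow_eq_lintegral (f := f) (μ := (volume : Measure ℝ)) (p := 2)
    two_ne_zero
  simpa using h

namespace IsSchurKernel

variable {K : ℝ → ℝ → ℂ} {A : ℝ≥0}

/-- The Schur test: weighted Cauchy–Schwarz in `y` spends the bound on the rows, then Tonelli and
the bound on the columns give the second factor `A`. -/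
theorem lintegral_sq_le (hK : IsSchurKernel K A) {g : ℝ → ℝ≥0∞} (hg : Measurable g) :
    ∫⁻ x, (∫⁻ y, ‖K x y‖ₑ * g y) ^ 2 ≤ A ^ 2 * ∫⁻ y, g y ^ 2 := by
  have hm := hK.measurable.enorm
  calc ∫⁻ x, (∫⁻ y, ‖K x y‖ₑ * g y) ^ 2
      ≤ ∫⁻ x, A * ∫⁻ y, ‖K x y‖ₑ * g y ^ 2 := by
        refine lintegral_mono fun x ↦ ?_
        refine (sq_lintegral_mul_le volume (hm.comp measurable_prodMk_left) hg).trans ?_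
        exact mul_le_mul_left (hK.lintegral_right_le x) _
    _ = A * ∫⁻ x, ∫⁻ y, ‖K x y‖ₑ * g y ^ 2 := by
        rw [lintegral_const_mul' _ _ ENNReal.coe_ne_top]
    _ = A * ∫⁻ y, ∫⁻ x, ‖K x y‖ₑ * g y ^ 2 := by
        rw [lintegral_lintegral_swap]
        exact (hm.mul ((hg.pow_const 2).comp measurable_snd)).aemeasurable
    _ = A * ∫⁻ y, (∫⁻ x, ‖K x y‖ₑ) * g y ^ 2 := by
        congr 1
        refine lintegral_congr fun y ↦ ?_
        exact lintegral_mul_const _ (hm.comp measurable_prodMk_right)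
    _ ≤ A * ∫⁻ y, A * g y ^ 2 := by
        gcongr with y
        exact hK.lintegral_left_le y
    _ = A ^ 2 * ∫⁻ y, g y ^ 2 := by
        rw [lintegral_const_mul' _ _ ENNReal.coe_ne_top, ← mul_assoc, sq]

theorem lintegral_sq_lt_top (hK : IsSchurKernel K A) (f : L2R) :
    ∫⁻ x, (∫⁻ y, ‖K x y‖ₑ * ‖f y‖ₑ) ^ 2 < ⊤ := by
  refine (hK.lintegral_sq_le (Lp.stronglyMeasurable f).measurable.enorm).trans_lt ?_
  rw [← eLpNorm_two_sq]
  exact ENNReal.mul_lt_top (ENNReal.pow_lt_top ENNReal.coe_lt_top)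
    (ENNReal.pow_lt_top (Lp.eLpNorm_lt_top f))

theorem measurable_mul (hK : IsSchurKernel K A) (f : L2R) :
    Measurable (Function.uncurry fun x y ↦ K x y * f y) :=
  hK.measurable.mul ((Lp.stronglyMeasurable f).measurable.comp measurable_snd)

theorem measurable_lintegral (hK : IsSchurKernel K A) (f : L2R) :
    Measurable fun x ↦ ∫⁻ y, ‖K x y‖ₑ * ‖f y‖ₑ :=
  Measurable.lintegral_prod_right (hK.measurable.enorm.mul
    ((Lp.stronglyMeasurable f).measurable.enorm.comp measurable_snd))

theorem ae_integrable (hK : IsSchurKernel K A) (f : L2R) :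
    ∀ᵐ x : ℝ, Integrable fun y ↦ K x y * f y := by
  filter_upwards [ae_lt_top ((hK.measurable_lintegral f).pow_const 2)
    (hK.lintegral_sq_lt_top f).ne] with x hx
  refine ⟨((hK.measurable_mul f).comp measurable_prodMk_left).aestronglyMeasurable, ?_⟩
  rw [hasFiniteIntegral_iff_enorm]
  simp only [enorm_mul]
  by_contra h
  rw [not_lt_top_iff] at h
  simp [h] at hx

theorem stronglyMeasurable_integral (hK : IsSchurKernel K A) (f : L2R) :
    StronglyMeasurable fun x ↦ ∫ y, K x y * f y :=
  (hK.measurable_mul f).stronglyMeasurable.integral_prod_right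

theorem eLpNorm_integral_le (hK : IsSchurKernel K A) (f : L2R) :
    eLpNorm (fun x ↦ ∫ y, K x y * f y) 2 volume ≤ A * eLpNorm f 2 volume := by
  rw [← ENNReal.pow_le_pow_left_iff two_ne_zero, mul_pow, eLpNorm_two_sq, eLpNorm_two_sq]
  refine le_trans (lintegral_mono fun x ↦ ?_)
    (hK.lintegral_sq_le (Lp.stronglyMeasurable f).measurable.enorm)
  refine pow_le_pow_left' ((enorm_integral_le_lintegral_enorm _).trans (le_of_eq ?_)) 2
  simp only [enorm_mul]

theorem memLp_integral (hK : IsSchurKernel K A) (f : L2R) :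
    MemLp (fun x ↦ ∫ y, K x y * f y) 2 volume :=
  ⟨(hK.stronglyMeasurable_integral f).aestronglyMeasurable,
    (hK.eLpNorm_integral_le f).trans_lt (ENNReal.mul_lt_top ENNReal.coe_lt_top
      (Lp.eLpNorm_lt_top f))⟩

theorem norm_le (hK : IsSchurKernel K A) {L : L2R →L[ℂ] L2R} (hL : HasKernel L K) : ‖L‖ ≤ A := by
  refine L.opNorm_le_bound A.2 fun f ↦ ?_
  rw [Lp.norm_def, Lp.norm_def, eLpNorm_congr_ae (hL f)]
  have h := ENNReal.toReal_mono (ENNReal.mul_lt_top ENNReal.coe_lt_top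
      (Lp.eLpNorm_lt_top f)).ne (hK.eLpNorm_integral_le f)
  simpa [ENNReal.toReal_mul] using h

theorem exists_hasKernel (hK : IsSchurKernel K A) : ∃ L : L2R →L[ℂ] L2R, HasKernel L K := by
  let T : L2R →ₗ[ℂ] L2R :=
    { toFun := fun f ↦ (hK.memLp_integral f).toLp
      map_add' := fun f g ↦ by
        refine Lp.ext ?_
        filter_upwards [(hK.memLp_integral (f + g)).coeFn_toLp, (hK.memLp_integral f).coeFn_toLp,
          (hK.memLp_integral g).coeFn_toLp, hK.ae_integrable f, hK.ae_integrable g,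
          Lp.coeFn_add (hK.memLp_integral f).toLp (hK.memLp_integral g).toLp]
          with x h1 h2 h3 h4 h5 h6
        rw [h1, h6, Pi.add_apply, h2, h3, ← integral_add h4 h5]
        refine integral_congr_ae ?_
        filter_upwards [Lp.coeFn_add f g] with y hy
        rw [hy, Pi.add_apply, mul_add]
      map_smul' := fun c f ↦ by
        refine Lp.ext ?_
        filter_upwards [(hK.memLp_integral (c • f)).coeFn_toLp, (hK.memLp_integral f).coeFn_toLp,
          Lp.coeFn_smul c (hK.memLp_integral f).toLp] with x h1 h2 h3
        rw [h1, RingHom.id_apply, h3, Pi.smul_apply, h2, smul_eq_mul, ← integral_const_mul]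
        refine integral_congr_ae ?_
        filter_upwards [Lp.coeFn_smul c f] with y hy
        rw [hy, Pi.smul_apply, smul_eq_mul]
        ring }
  refine ⟨T.mkContinuous A fun f ↦ ?_, fun f ↦ (hK.memLp_integral f).coeFn_toLp⟩
  change ‖(hK.memLp_integral f).toLp‖ ≤ _
  rw [Lp.norm_toLp, Lp.norm_def]
  have h := ENNReal.toReal_mono (ENNReal.mul_lt_top ENNReal.coe_lt_top
      (Lp.eLpNorm_lt_top f)).ne (hK.eLpNorm_integral_le f)
  simpa [ENNReal.toReal_mul] using h

theorem integrable_prod (hK : IsSchurKernel K A) (f : L2R) {φ : ℝ → ℂ} (hφ : Measurable φ)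
    (hφ2 : MemLp φ 2 volume) :
    Integrable (fun p : ℝ × ℝ ↦ φ p.1 * (K p.1 p.2 * f p.2)) (volume.prod volume) := by
  have hm : Measurable fun p : ℝ × ℝ ↦ φ p.1 * (K p.1 p.2 * f p.2) :=
    (hφ.comp measurable_fst).mul (hK.measurable_mul f)
  refine ⟨hm.aestronglyMeasurable, ?_⟩
  rw [hasFiniteIntegral_iff_enorm, lintegral_prod _ hm.enorm.aemeasurable]
  have h1 : ∫⁻ x, ‖φ x‖ₑ ^ 2 < ⊤ := by
    rw [← eLpNorm_two_sq]
    exact ENNReal.pow_lt_top hφ2.2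
  -- The crude inequality `a b ≤ a² + b²` separates the test function from the operator, both of
  -- which are square integrable.
  have h2 : ∀ x, ∫⁻ y, ‖φ x * (K x y * f y)‖ₑ ≤
      ‖φ x‖ₑ ^ 2 + (∫⁻ y, ‖K x y‖ₑ * ‖f y‖ₑ) ^ 2 := by
    intro x
    simp only [enorm_mul]
    rw [lintegral_const_mul' _ _ enorm_ne_top]
    generalize ‖φ x‖ₑ = a
    generalize ∫⁻ y, ‖K x y‖ₑ * ‖f y‖ₑ = b
    rcases le_total a b with h | h
    · calc a * b ≤ b * b := by gcongr
        _ = b ^ 2 := (sq b).symm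
        _ ≤ a ^ 2 + b ^ 2 := le_add_self
    · calc a * b ≤ a * a := by gcongr
        _ = a ^ 2 := (sq a).symm
        _ ≤ a ^ 2 + b ^ 2 := le_self_add
  refine (lintegral_mono h2).trans_lt ?_
  rw [lintegral_add_left (hφ.enorm.pow_const 2)]
  exact ENNReal.add_lt_top.2 ⟨h1, hK.lintegral_sq_lt_top f⟩

/-- Fubini's theorem for an integral operator tested against `φ`. -/
theorem integral_apply_mul (hK : IsSchurKernel K A) {L : L2R →L[ℂ] L2R} (hL : HasKernel L K)
    (f : L2R) {φ : ℝ → ℂ} (hφ : Measurable φ) (hφ2 : MemLp φ 2 volume) :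
    ∫ x, L f x * φ x = ∫ y, (∫ x, K x y * φ x) * f y := by
  calc ∫ x, L f x * φ x = ∫ x, ∫ y, φ x * (K x y * f y) := by
        refine integral_congr_ae ?_
        filter_upwards [hL f] with x hx
        rw [hx, integral_const_mul, mul_comm]
    _ = ∫ y, ∫ x, φ x * (K x y * f y) := integral_integral_swap (hK.integrable_prod f hφ hφ2)
    _ = ∫ y, (∫ x, K x y * φ x) * f y := by
        refine integral_congr_ae (.of_forall fun y ↦ ?_)
        simp only
        rw [← integral_mul_const]
        congr 1
        ext x
        ring

theorem ofBoundedOn {N : ℕ} {C : ℝ≥0} (hm : Measurable (Function.uncurry K))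
    (hC : ∀ x y, ‖K x y‖ ≤ C)
    (h0 : ∀ x y, ¬ (x ∈ Icc (-(N : ℝ)) N ∧ y ∈ Icc (-(N : ℝ)) N) → K x y = 0) :
    IsSchurKernel K (C * (2 * N)) := by
  have hb : ∀ g : ℝ → ℂ, (∀ x, ‖g x‖ ≤ C) → (∀ x, x ∉ Icc (-(N : ℝ)) N → g x = 0) →
      ∫⁻ x, ‖g x‖ₑ ≤ (C * (2 * N) : ℝ≥0) := by
    intro g hg hg0
    have : ∀ x, ‖g x‖ₑ ≤ (Icc (-(N : ℝ)) N).indicator (fun _ ↦ (C : ℝ≥0∞)) x := by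
      intro x
      by_cases hx : x ∈ Icc (-(N : ℝ)) N
      · rw [indicator_of_mem hx]
        exact ENNReal.coe_le_coe.2 (hg x)
      · rw [indicator_of_notMem hx, hg0 x hx, enorm_zero]
    refine (lintegral_mono this).trans ?_
    rw [lintegral_indicator measurableSet_Icc, setLIntegral_const, Real.volume_Icc,
      show (N : ℝ) - -(N : ℝ) = ((2 * N : ℝ≥0) : ℝ) by push_cast; ring, ENNReal.ofReal_coe_nnreal]
    push_cast
    exact le_rfl
  exact ⟨hm, fun x ↦ hb _ (hC x) fun y hy ↦ h0 _ _ fun h ↦ hy h.2,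
    fun y ↦ hb _ (fun x ↦ hC x y) fun x hx ↦ h0 _ _ fun h ↦ hx h.1⟩

end IsSchurKernel

theorem HasKernel.unique {K : ℝ → ℝ → ℂ} {L L' : L2R →L[ℂ] L2R} (h : HasKernel L K)
    (h' : HasKernel L' K) : L = L' := by
  ext1 f
  refine Lp.ext ?_
  filter_upwards [h f, h' f] with x h1 h2
  rw [h1, h2]

theorem HasKernel.const_smul {K : ℝ → ℝ → ℂ} {L : L2R →L[ℂ] L2R} (h : HasKernel L K) (c : ℂ) :
    HasKernel (c • L) fun x y ↦ c * K x y := by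
  intro f
  filter_upwards [h f, Lp.coeFn_smul c (L f)] with x h1 h2
  rw [_root_.smul_apply, h2, Pi.smul_apply, h1, smul_eq_mul, ← integral_const_mul]
  simp only [mul_assoc]

theorem HasKernel.sub {K K' : ℝ → ℝ → ℂ} {A A' : ℝ≥0} {L L' : L2R →L[ℂ] L2R}
    (h : HasKernel L K) (h' : HasKernel L' K') (hK : IsSchurKernel K A)
    (hK' : IsSchurKernel K' A') : HasKernel (L - L') fun x y ↦ K x y - K' x y := by
  intro f
  filter_upwards [h f, h' f, Lp.coeFn_sub (L f) (L' f), hK.ae_integrable f, hK'.ae_integrable f]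
    with x h1 h2 h3 h4 h5
  rw [_root_.sub_apply, h3, Pi.sub_apply, h1, h2, ← integral_sub h4 h5]
  simp only [sub_mul]

/-! ### Holomorphic families of integral operators -/

/-- Cauchy's estimate on unit circles centred in the ball of radius `1` bounds the second derivative
by `2! C`, and the mean value inequality is then applied twice. The constant depends only on the
supremum of `g`, which makes the estimate uniform over a family of kernels. -/
theorem norm_sub_sub_mul_deriv_le {g : ℂ → ℂ} (hg : Differentiable ℂ g) {c : ℂ} {C : ℝ}
    (hC : ∀ z ∈ Metric.closedBall c 2, ‖g z‖ ≤ C) {z : ℂ} (hz : z ∈ Metric.closedBall c 1) :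
    ‖g z - g c - (z - c) * deriv g c‖ ≤ 2 * C * ‖z - c‖ ^ 2 := by
  have hC0 : 0 ≤ C := (norm_nonneg _).trans (hC c (by simp))
  have hg' : Differentiable ℂ (deriv g) := fun z ↦
    ((hg.analyticAt z).deriv).differentiableAt
  have h2 : ∀ z ∈ Metric.closedBall c 1, ‖deriv (deriv g) z‖ ≤ 2 * C := by
    intro z hz
    have h := Complex.norm_iteratedDeriv_le_of_forall_mem_sphere_norm_le 2 one_pos
      (hg.diffContOnCl (s := Metric.ball z 1)) (C := C) fun w hw ↦ hC w ?_
    · simpa [iteratedDeriv_succ, iteratedDeriv_one] using h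
    · rw [Metric.mem_closedBall] at hz ⊢
      rw [Metric.mem_sphere] at hw
      linarith [dist_triangle w z c]
  have hconv := convex_closedBall c (1 : ℝ)
  have hcc : c ∈ Metric.closedBall c (1 : ℝ) := by simp
  have h1 : ∀ w ∈ Metric.closedBall c 1, ‖deriv g w - deriv g c‖ ≤ 2 * C * ‖w - c‖ := fun w hw ↦
    hconv.norm_image_sub_le_of_norm_deriv_le (fun x _ ↦ hg' x) h2 hcc hw
  have hsub : Metric.closedBall c ‖z - c‖ ⊆ Metric.closedBall c 1 :=
    Metric.closedBall_subset_closedBall (by simpa [dist_eq_norm] using hz)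
  have hd : ∀ w : ℂ, HasDerivAt (fun w ↦ g w - (w - c) * deriv g c)
      (deriv g w - deriv g c) w := fun w ↦
    ((hg w).hasDerivAt.sub (((hasDerivAt_id w).sub_const c).mul_const (deriv g c))).congr_deriv
      (by rw [one_mul])
  have h := (convex_closedBall c ‖z - c‖).norm_image_sub_le_of_norm_hasDerivWithin_le
    (C := 2 * C * ‖z - c‖) (fun w _ ↦ (hd w).hasDerivWithinAt) (fun w hw ↦
      (h1 w (hsub hw)).trans (by
        gcongr
        simpa [dist_eq_norm] using hw)) (x := c) (y := z) (by simp) (by simp [dist_eq_norm])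
  calc ‖g z - g c - (z - c) * deriv g c‖
      = ‖g z - (z - c) * deriv g c - (g c - (c - c) * deriv g c)‖ := by
        congr 1
        ring
    _ ≤ _ := h
    _ = _ := by ring

/-- A family of integral operators on a bounded interval is entire if its kernels are entire and
locally bounded. -/
theorem differentiable_of_hasKernel {N : ℕ} {K : ℂ → ℝ → ℝ → ℂ} {T : ℂ → L2R →L[ℂ] L2R}
    (hT : ∀ lam, HasKernel (T lam) (K lam))
    (hm : ∀ lam, Measurable (Function.uncurry (K lam)))
    (h0 : ∀ lam x y, ¬ (x ∈ Icc (-(N : ℝ)) N ∧ y ∈ Icc (-(N : ℝ)) N) → K lam x y = 0)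
    (hd : ∀ x y, Differentiable ℂ fun lam ↦ K lam x y)
    (hC : ∀ r : ℝ, ∃ C : ℝ≥0, ∀ lam ∈ Metric.closedBall 0 r, ∀ x y, ‖K lam x y‖ ≤ C) :
    Differentiable ℂ T := by
  intro lam
  obtain ⟨C, hC⟩ := hC (‖lam‖ + 2)
  have hC2 : ∀ z ∈ Metric.closedBall lam 2, ∀ x y, ‖K z x y‖ ≤ C := fun z hz ↦ hC z <| by
    rw [Metric.mem_closedBall, dist_eq_norm] at hz
    rw [mem_closedBall_zero_iff]
    calc ‖z‖ = ‖(z - lam) + lam‖ := by rw [sub_add_cancel]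
      _ ≤ ‖z - lam‖ + ‖lam‖ := norm_add_le _ _
      _ ≤ ‖lam‖ + 2 := by linarith
  have hS : ∀ z ∈ Metric.closedBall lam 2, IsSchurKernel (K z) (C * (2 * N)) := fun z hz ↦
    IsSchurKernel.ofBoundedOn (hm z) (hC2 z hz) (h0 z)
  set K' : ℝ → ℝ → ℂ := fun x y ↦ deriv (fun z ↦ K z x y) lam with hK'
  have hK'm : Measurable (Function.uncurry K') := by
    -- The kernel of the derivative is a pointwise limit of difference quotients along the
    -- increments `1 / (n + 1)`.
    refine measurable_of_tendsto_metrizable (f := fun (n : ℕ) (p : ℝ × ℝ) ↦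
      ((1 / ((n : ℂ) + 1)))⁻¹ • (K (lam + 1 / ((n : ℂ) + 1)) p.1 p.2 - K lam p.1 p.2)) ?_ ?_
    · exact fun n ↦ ((hm (lam + 1 / ((n : ℂ) + 1))).sub (hm lam)).const_smul
        (1 / ((n : ℂ) + 1))⁻¹
    · rw [tendsto_pi_nhds]
      rintro ⟨x, y⟩
      have h := (hd x y lam).hasDerivAt.tendsto_slope_zero
      refine h.comp (f := fun n : ℕ ↦ 1 / ((n : ℂ) + 1)) ?_
      refine tendsto_nhdsWithin_iff.2 ⟨tendsto_one_div_add_atTop_nhds_zero_nat, ?_⟩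
      exact Eventually.of_forall fun n ↦ by
        simpa using Nat.cast_add_one_ne_zero (R := ℂ) n
  have hK'C : ∀ x y, ‖K' x y‖ ≤ C := fun x y ↦ by
    have h := Complex.norm_deriv_le_of_forall_mem_sphere_norm_le one_pos
      ((hd x y).diffContOnCl (s := Metric.ball lam 1)) (C := C) fun w hw ↦ hC2 w ?_ x y
    · simpa using h
    · rw [Metric.mem_sphere] at hw
      rw [Metric.mem_closedBall, hw]
      norm_num
  have hK'0 : ∀ x y, ¬ (x ∈ Icc (-(N : ℝ)) N ∧ y ∈ Icc (-(N : ℝ)) N) → K' x y = 0 := by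
    intro x y h
    simp only [hK', h0 _ x y h, deriv_const]
  have hS' : IsSchurKernel K' (C * (2 * N)) := IsSchurKernel.ofBoundedOn hK'm hK'C hK'0
  obtain ⟨L, hL⟩ := hS'.exists_hasKernel
  have hlam : lam ∈ Metric.closedBall lam 2 := by simp
  suffices HasDerivAt T L lam from this.differentiableAt
  rw [hasDerivAt_iff_isLittleO]
  -- The kernel of the Taylor remainder is `O(‖z - lam‖²)` uniformly on the square, so the Schur
  -- bound gives the same for the operator norm.
  refine Asymptotics.IsBigO.trans_isLittleO (g := fun z ↦ ‖z - lam‖ ^ 2) ?_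
    (Asymptotics.isLittleO_pow_sub_sub lam one_lt_two)
  refine Asymptotics.IsBigO.of_bound (2 * C * (2 * N)) ?_
  filter_upwards [Metric.closedBall_mem_nhds lam one_pos] with z hz
  have hz2 : z ∈ Metric.closedBall lam 2 :=
    Metric.closedBall_subset_closedBall (by norm_num) hz
  have hk1 := (hT z).sub (hT lam) (hS z hz2) (hS lam hlam)
  have hk1S : IsSchurKernel (fun x y ↦ K z x y - K lam x y) ((C + C) * (2 * N)) :=
    IsSchurKernel.ofBoundedOn ((hm z).sub (hm lam)) (fun x y ↦ (norm_sub_le _ _).trans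
      (add_le_add (hC2 z hz2 x y) (hC2 lam hlam x y)))
      (fun x y h ↦ by rw [h0 _ _ _ h, h0 _ _ _ h, sub_zero])
  have hk2 := hL.const_smul (z - lam)
  have hk2S : IsSchurKernel (fun x y ↦ (z - lam) * K' x y) (‖z - lam‖₊ * C * (2 * N)) :=
    IsSchurKernel.ofBoundedOn (hK'm.const_mul _) (fun x y ↦ by
      rw [norm_mul]
      push_cast
      gcongr
      exact hK'C x y) (fun x y h ↦ by rw [hK'0 _ _ h, mul_zero])
  have hk3 := hk1.sub hk2 hk1S hk2S
  have hk3S : IsSchurKernel (fun x y ↦ K z x y - K lam x y - (z - lam) * K' x y)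
      (2 * C * ‖z - lam‖₊ ^ 2 * (2 * N)) :=
    IsSchurKernel.ofBoundedOn (((hm z).sub (hm lam)).sub (hK'm.const_mul _))
      (fun x y ↦ by
        have := norm_sub_sub_mul_deriv_le (hd x y) (fun w hw ↦ hC2 w hw x y) hz
        simpa using this)
      (fun x y h ↦ by rw [h0 _ _ _ h, h0 _ _ _ h, hK'0 _ _ h]; simp)
  refine (hk3S.norm_le hk3).trans (le_of_eq ?_)
  push_cast
  rw [norm_pow, norm_norm]
  ring

/-! ### Weak derivatives -/

theorem integral_Iic_of_hasDerivAt_off_countable {F F' : ℝ → ℂ} {s : Set ℝ} (hs : s.Countable)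
    (hc : Continuous F) (hd : ∀ x ∉ s, HasDerivAt F (F' x) x) (hi : Integrable F')
    (hF : HasCompactSupport F) (y : ℝ) : ∫ x in Iic y, F' x = F y := by
  have h1 := intervalIntegral_tendsto_integral_Iic (μ := volume) y hi.integrableOn tendsto_id
  have h2 : Tendsto (fun R ↦ F y - F R) atBot (𝓝 (F y - 0)) :=
    (hF.is_zero_at_infty.mono_left atBot_le_cocompact).const_sub _
  rw [sub_zero] at h2
  refine tendsto_nhds_unique (h1.congr fun R ↦ ?_) h2
  exact integral_eq_of_hasDerivAt_off_countable F F' hs hc.continuousOn (fun x hx ↦ hd x hx.2)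
    hi.intervalIntegrable

theorem integral_Ioi_of_hasDerivAt_off_countable {F F' : ℝ → ℂ} {s : Set ℝ} (hs : s.Countable)
    (hc : Continuous F) (hd : ∀ x ∉ s, HasDerivAt F (F' x) x) (hi : Integrable F')
    (hF : HasCompactSupport F) (y : ℝ) : ∫ x in Ioi y, F' x = - F y := by
  have h1 := intervalIntegral_tendsto_integral_Ioi (μ := volume) y hi.integrableOn tendsto_id
  have h2 : Tendsto (fun R ↦ F R - F y) atTop (𝓝 (0 - F y)) :=
    (hF.is_zero_at_infty.mono_left atTop_le_cocompact).sub_const _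
  rw [zero_sub] at h2
  refine tendsto_nhds_unique (h1.congr fun R ↦ ?_) h2
  exact integral_eq_of_hasDerivAt_off_countable F F' hs hc.continuousOn (fun x hx ↦ hd x hx.2)
    hi.intervalIntegrable

/-- Integration by parts against a test function, for a function with a jump at `y`. -/
theorem integral_ite_mul_deriv {f f' g g' φ : ℝ → ℂ} {s : Set ℝ} (hs : s.Countable)
    (hf : Continuous f) (hg : Continuous g) (hf' : LocallyIntegrable f' volume)
    (hg' : LocallyIntegrable g' volume) (hfd : ∀ x ∉ s, HasDerivAt f (f' x) x)
    (hgd : ∀ x ∉ s, HasDerivAt g (g' x) x) (hφ : ContDiff ℝ ∞ φ) (hφc : HasCompactSupport φ)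
    (y : ℝ) :
    ∫ x, (if x ≤ y then f x else g x) * deriv φ x =
      (f y - g y) * φ y - ∫ x, (if x ≤ y then f' x else g' x) * φ x := by
  have hφd : Continuous (deriv φ) := hφ.continuous_deriv (by norm_num)
  have hder : ∀ x, HasDerivAt φ (deriv φ x) x := fun x ↦
    (hφ.differentiable (by norm_num) x).hasDerivAt
  have hint : ∀ {h h' : ℝ → ℂ}, Continuous h → LocallyIntegrable h' volume →
      Integrable (fun x ↦ h x * deriv φ x) ∧ Integrable (fun x ↦ h' x * φ x) := by
    intro h h' hh hh'
    refine ⟨(hh.mul hφd).integrable_of_hasCompactSupport hφc.deriv.mul_left, ?_⟩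
    simpa only [smul_eq_mul] using
      hh'.integrable_smul_right_of_hasCompactSupport hφ.continuous hφc
  obtain ⟨if1, if2⟩ := hint hf hf'
  obtain ⟨ig1, ig2⟩ := hint hg hg'
  have hsplit : ∀ {p q : ℝ → ℂ}, Integrable p → Integrable q →
      ∫ x, (if x ≤ y then p x else q x) = (∫ x in Iic y, p x) + ∫ x in Ioi y, q x := by
    intro p q hp hq
    have h := integral_piecewise (measurableSet_Iic (a := y)) hp.integrableOn
      (hq.integrableOn (s := (Iic y)ᶜ))
    rw [compl_Iic] at h
    rw [← h]
    congr 1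
  simp only [ite_mul]
  rw [hsplit if1 ig1, hsplit if2 ig2]
  have h1 := integral_Iic_of_hasDerivAt_off_countable hs (hf.mul hφ.continuous)
    (fun x hx ↦ (hfd x hx).mul (hder x)) (if2.add if1) hφc.mul_left y
  have h2 := integral_Ioi_of_hasDerivAt_off_countable hs (hg.mul hφ.continuous)
    (fun x hx ↦ (hgd x hx).mul (hder x)) (ig2.add ig1) hφc.mul_left y
  rw [integral_add if2.integrableOn if1.integrableOn] at h1
  rw [integral_add ig2.integrableOn ig1.integrableOn] at h2
  simp only [Pi.mul_apply] at h1 h2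
  linear_combination h1 + h2

theorem locallyIntegrable_L2R (w : L2R) : LocallyIntegrable w volume :=
  (Lp.memLp w).locallyIntegrable (by norm_num)

theorem intervalIntegrable_L2R (w : L2R) (a b : ℝ) : IntervalIntegrable w volume a b :=
  ((locallyIntegrable_L2R w).integrableOn_isCompact isCompact_uIcc).intervalIntegrable

theorem continuous_primitive_L2R (w : L2R) : Continuous fun x ↦ ∫ t in (0 : ℝ)..x, w t :=
  intervalIntegral.continuous_primitive
    (intervalIntegrable_L2R w) 0

/-- Integration by parts for the primitive of a locally integrable function. -/
theorem integral_primitive_mul_deriv (w : L2R) {φ : ℝ → ℂ} (hφ : ContDiff ℝ ∞ φ)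
    (hφc : HasCompactSupport φ) :
    ∫ x, (∫ t in (0 : ℝ)..x, w t) * deriv φ x = - ∫ x, w x * φ x := by
  have hφ1 : ContDiff ℝ 1 φ := hφ.of_le (by exact_mod_cast le_top)
  have hφd : Continuous (deriv φ) := hφ.continuous_deriv (by norm_num)
  have hwl := locallyIntegrable_L2R w
  have hdi : Integrable (deriv φ) := hφd.integrable_of_hasCompactSupport hφc.deriv
  have hzero : ∫ x, deriv φ x = 0 := by
    have h1 := hφc.integral_Iic_deriv_eq hφ1 0
    have h2 := hφc.integral_Ioi_deriv_eq hφ1 0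
    rw [← intervalIntegral.integral_Iic_add_Ioi (b := 0) hdi.integrableOn hdi.integrableOn, h1,
      h2, add_neg_cancel]
  obtain ⟨R, hR⟩ := hφc.isCompact.isBounded.subset_closedBall (0 : ℝ)
  have hsub : tsupport φ ⊆ Icc (-R) R := by simpa [Real.closedBall_eq_Icc] using hR
  have hout : ∀ x, x ∉ Icc (-R) R → φ x = 0 ∧ deriv φ x = 0 := fun x hx ↦
    ⟨image_eq_zero_of_notMem_tsupport fun h ↦ hx (hsub h),
      image_eq_zero_of_notMem_tsupport fun h ↦ hx (hsub (tsupport_deriv_subset h))⟩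
  -- Fubini for `φ'(x) w(y)` over `y < x`, with `w` cut to `[-R, R]` for integrability. Integrating
  -- in `y` first yields the primitive based at `-R`; moving the base point to `0` costs a multiple
  -- of `∫ φ' = 0`.
  set w₁ : ℝ → ℂ := (Icc (-R) R).indicator w with hw₁
  have hw₁i : Integrable w₁ :=
    (hwl.integrableOn_isCompact isCompact_Icc).integrable_indicator measurableSet_Icc
  have hprod : Integrable (fun p : ℝ × ℝ ↦ {p : ℝ × ℝ | p.2 < p.1}.indicator
      (fun p ↦ deriv φ p.1 * w₁ p.2) p) (volume.prod volume) :=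
    (hdi.mul_prod hw₁i).indicator (measurableSet_lt measurable_snd measurable_fst)
  have hswap := integral_integral_swap (f := fun x y ↦ {p : ℝ × ℝ | p.2 < p.1}.indicator
      (fun p ↦ deriv φ p.1 * w₁ p.2) (x, y)) hprod
  have hleft : ∀ x, ∫ y, {p : ℝ × ℝ | p.2 < p.1}.indicator
      (fun p ↦ deriv φ p.1 * w₁ p.2) (x, y) =
      (∫ t in (0 : ℝ)..x, w t) * deriv φ x + (∫ t in (-R)..0, w t) * deriv φ x := by
    intro x
    have h1 : (fun y ↦ {p : ℝ × ℝ | p.2 < p.1}.indicator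
        (fun p ↦ deriv φ p.1 * w₁ p.2) (x, y)) = (Iio x).indicator fun y ↦ deriv φ x * w₁ y := by
      ext y
      simp [indicator]
    rw [h1, integral_indicator measurableSet_Iio, integral_const_mul]
    by_cases hx : x ∈ Icc (-R) R
    · have hset : Iio x ∩ Icc (-R) R = Ico (-R) x := by
        ext t
        have := hx.2
        exact ⟨fun h ↦ ⟨h.2.1, h.1⟩, fun h ↦ ⟨h.2, h.1, h.2.le.trans this⟩⟩
      rw [← add_mul, add_comm, intervalIntegral.integral_add_adjacent_intervals
        (intervalIntegrable_L2R w _ _) (intervalIntegrable_L2R w _ _), mul_comm,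
        intervalIntegral.integral_of_le hx.1, hw₁, setIntegral_indicator measurableSet_Icc,
        ← integral_Icc_eq_integral_Ioc, integral_Icc_eq_integral_Ico, hset]
    · rw [(hout x hx).2]
      simp
  have hright : ∀ y, ∫ x, {p : ℝ × ℝ | p.2 < p.1}.indicator
      (fun p ↦ deriv φ p.1 * w₁ p.2) (x, y) = - (w y * φ y) := by
    intro y
    have h1 : (fun x ↦ {p : ℝ × ℝ | p.2 < p.1}.indicator
        (fun p ↦ deriv φ p.1 * w₁ p.2) (x, y)) = (Ioi y).indicator fun x ↦ deriv φ x * w₁ y := by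
      ext x
      simp [indicator]
    rw [h1, integral_indicator measurableSet_Ioi, integral_mul_const,
      hφc.integral_Ioi_deriv_eq hφ1]
    by_cases hy : y ∈ Icc (-R) R
    · rw [hw₁, indicator_of_mem hy]
      ring
    · rw [(hout y hy).1]
      simp
  simp only [hleft, hright] at hswap
  have hi1 : Integrable fun x ↦ (∫ t in (0 : ℝ)..x, w t) * deriv φ x :=
    ((continuous_primitive_L2R w).mul hφd).integrable_of_hasCompactSupport hφc.deriv.mul_left
  rw [integral_add hi1 (hdi.const_mul _), integral_const_mul, hzero, integral_neg] at hswap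
  simpa using hswap

/-- A locally integrable function with vanishing weak derivative is constant. -/
theorem ae_eq_const_of_integral_mul_deriv_eq_zero {h : ℝ → ℂ} (hh : LocallyIntegrable h volume)
    (h0 : ∀ φ : ℝ → ℂ, ContDiff ℝ ∞ φ → HasCompactSupport φ → ∫ x, h x * deriv φ x = 0) :
    ∃ c : ℂ, ∀ᵐ x : ℝ, h x = c := by
  let B : ContDiffBump (0 : ℝ) := ⟨1, 2, one_pos, one_lt_two⟩
  set χ : ℝ → ℝ := B.normed volume with hχ
  have hχs : ContDiff ℝ ∞ χ := B.contDiff_normed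
  have hχc : HasCompactSupport χ := B.hasCompactSupport_normed
  have hχ1 : ∫ x, χ x = 1 := B.integral_normed
  refine ⟨∫ x, χ x • h x, ?_⟩
  set c := ∫ x, χ x • h x with hc
  suffices ∀ᵐ x : ℝ, h x - c = 0 from this.mono fun x hx ↦ sub_eq_zero.1 hx
  refine ae_eq_zero_of_integral_contDiff_smul_eq_zero (hh.sub (locallyIntegrable_const c)) ?_
  intro ψ hψ hψc
  set m := ∫ x, ψ x with hm
  -- Subtracting a multiple of a bump of integral one makes the mean vanish, so that the primitive
  -- of `θ` is again compactly supported and is an admissible test function.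
  set θ : ℝ → ℝ := fun x ↦ ψ x - m * χ x with hθ
  have hθs : ContDiff ℝ ∞ θ := hψ.sub (contDiff_const.mul hχs)
  have hθc : HasCompactSupport θ := hψc.sub hχc.mul_left
  have hψi : Integrable ψ := hψ.continuous.integrable_of_hasCompactSupport hψc
  have hχi : Integrable χ := hχs.continuous.integrable_of_hasCompactSupport hχc
  have hθi : Integrable θ := hψi.sub (hχi.const_mul m)
  have hθ0 : ∫ x, θ x = 0 := by
    rw [hθ, integral_sub hψi (hχi.const_mul m), integral_const_mul, hχ1, mul_one, sub_self]
  obtain ⟨R, hR⟩ := hθc.isCompact.isBounded.subset_closedBall (0 : ℝ)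
  have hsub : tsupport θ ⊆ Icc (-R) R := by simpa [Real.closedBall_eq_Icc] using hR
  have hout : ∀ x, x ∉ Icc (-R) R → θ x = 0 := fun x hx ↦
    image_eq_zero_of_notMem_tsupport fun h ↦ hx (hsub h)
  set Θ : ℝ → ℝ := fun x ↦ ∫ t in Iic x, θ t with hΘ
  have hΘd : ∀ x, HasDerivAt Θ (θ x) x := by
    intro x
    have h1 : Θ = fun x ↦ (∫ t in Iic 0, θ t) + ∫ t in (0 : ℝ)..x, θ t := by
      ext x
      rw [← intervalIntegral.integral_Iic_sub_Iic hθi.integrableOn hθi.integrableOn]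
      simp [hΘ]
    rw [h1]
    exact (hθs.continuous.integral_hasStrictDerivAt 0 x).hasDerivAt.const_add _
  have hΘ' : deriv Θ = θ := funext fun x ↦ (hΘd x).deriv
  have hΘs : ContDiff ℝ ∞ Θ :=
    contDiff_infty_iff_deriv.2 ⟨fun x ↦ (hΘd x).differentiableAt, hΘ' ▸ hθs⟩
  have hΘc : HasCompactSupport Θ := by
    refine HasCompactSupport.intro (isCompact_Icc (a := -R) (b := R)) fun x hx ↦ ?_
    rw [mem_Icc, not_and_or, not_le, not_le] at hx
    rcases hx with hx | hx
    · refine setIntegral_eq_zero_of_forall_eq_zero fun t ht ↦ hout t fun h ↦ ?_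
      exact absurd h.1 (not_le.2 (lt_of_le_of_lt ht hx))
    · rw [hΘ, ← hθ0]
      refine setIntegral_eq_integral_of_forall_compl_eq_zero fun t ht ↦ hout t fun h ↦ ?_
      rw [mem_Iic, not_le] at ht
      linarith [h.2]
  have h1 := h0 (fun x ↦ (Θ x : ℂ)) (Complex.ofRealCLM.contDiff.comp hΘs)
    (hΘc.comp_left Complex.ofReal_zero)
  have hd : ∀ x, deriv (fun x ↦ (Θ x : ℂ)) x = θ x := fun x ↦ (hΘd x).ofReal_comp.deriv
  have hi1 : Integrable fun x ↦ ψ x • h x :=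
    hh.integrable_smul_left_of_hasCompactSupport hψ.continuous hψc
  have hi2 : Integrable fun x ↦ χ x • h x :=
    hh.integrable_smul_left_of_hasCompactSupport hχs.continuous hχc
  have h2 : ∫ x, h x * deriv (fun x ↦ (Θ x : ℂ)) x = (∫ x, ψ x • h x) - m * c := by
    rw [hc, ← integral_const_mul, ← integral_sub hi1 (hi2.const_mul _)]
    refine integral_congr_ae (.of_forall fun x ↦ ?_)
    simp only [hd, hθ, Complex.real_smul]
    push_cast
    ring
  rw [h2] at h1
  have h3 : ∫ x, ψ x • (h x - c) = (∫ x, ψ x • h x) - m * c := by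
    simp only [smul_sub]
    rw [integral_sub hi1 (hψi.smul_const c), integral_smul_const, Complex.real_smul]
  exact h3.trans h1

/-- The difference of `u` and the primitive of `w` has zero weak derivative. This supplies the
continuous representatives on which classical ODE arguments can be run. -/
theorem HasWeakDeriv.exists_ae_eq_primitive {u w : L2R} (h : HasWeakDeriv u w) :
    ∃ c : ℂ, ∀ᵐ x : ℝ, u x = c + ∫ t in (0 : ℝ)..x, w t := by
  have hu := locallyIntegrable_L2R u
  have hW := continuous_primitive_L2R w
  obtain ⟨c, hc⟩ := ae_eq_const_of_integral_mul_deriv_eq_zero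
    (h := fun x ↦ u x - ∫ t in (0 : ℝ)..x, w t) (hu.sub hW.locallyIntegrable) fun φ hφ hφc ↦ by
      have hφd : Continuous (deriv φ) := hφ.continuous_deriv (by norm_num)
      simp only [sub_mul]
      rw [integral_sub, h φ hφ hφc, integral_primitive_mul_deriv w hφ hφc, sub_self]
      · simpa only [smul_eq_mul] using
          hu.integrable_smul_right_of_hasCompactSupport hφd hφc.deriv
      · exact (hW.mul hφd).integrable_of_hasCompactSupport hφc.deriv.mul_left
  refine ⟨c, hc.mono fun x hx ↦ ?_⟩
  linear_combination hx

/-! ### Jost solutions -/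

/-- The solution that is a left-going wave to the left of the structure. -/
def jostLeft (b₁ b₂ x₂ : ℝ) (k : ℕ) (lam : ℂ) (x : ℝ) : ℂ × ℂ :=
  sol b₁ b₂ x₂ k lam (b₁, -1) x

/-- The solution that is a right-going wave to the right of the structure. -/
def jostRight (b₁ b₂ x₂ : ℝ) (k : ℕ) (lam : ℂ) (x : ℝ) : ℂ × ℂ :=
  sol b₁ b₂ x₂ k lam ((cellInv b₁ b₂ x₂ lam)^[k] (b₁, 1)) x

/-- The Wronskian of the two Jost solutions; its zeros in the lower half plane are the
resonances. -/
def jostDet (b₁ b₂ x₂ : ℝ) (k : ℕ) (lam : ℂ) : ℂ :=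
  wronskian ((cell b₁ b₂ x₂ lam)^[k] (b₁, -1)) (b₁, 1)

section

variable {b₁ b₂ x₂ : ℝ}

theorem wronskian_iterate_cell (hb₁ : b₁ ≠ 0) (hb₂ : b₂ ≠ 0) (lam : ℂ) (k : ℕ) (w z : ℂ × ℂ) :
    wronskian ((cell b₁ b₂ x₂ lam)^[k] w) ((cell b₁ b₂ x₂ lam)^[k] z) = wronskian w z := by
  induction k with
  | zero => rfl
  | succ k ih =>
    rw [Function.iterate_succ_apply', Function.iterate_succ_apply', cell, cell,
      wronskian_layer hb₁, wronskian_layer hb₂, ih]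

/-- The Wronskian does not depend on `x`. Carried through the `k` cells to the right end, the data
of the right Jost solution become exactly `(b₁, 1)`. -/
theorem wronskian_jost (hb₁ : b₁ ≠ 0) (hb₂ : b₂ ≠ 0) (k : ℕ) (lam : ℂ) (x : ℝ) :
    wronskian (jostLeft b₁ b₂ x₂ k lam x) (jostRight b₁ b₂ x₂ k lam x)
      = jostDet b₁ b₂ x₂ k lam := by
  rw [jostLeft, jostRight, wronskian_sol hb₁ hb₂, ← wronskian_iterate_cell hb₁ hb₂ lam k,
    iterate_cell_iterate_cellInv hb₁ hb₂, jostDet]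

theorem differentiable_jostLeft (k : ℕ) (x : ℝ) :
    Differentiable ℂ fun lam ↦ jostLeft b₁ b₂ x₂ k lam x :=
  differentiable_sol k (differentiable_const _) x

theorem differentiable_jostRight (k : ℕ) (x : ℝ) :
    Differentiable ℂ fun lam ↦ jostRight b₁ b₂ x₂ k lam x :=
  differentiable_sol k (differentiable_iterate_cellInv (differentiable_const _) k) x

theorem differentiable_jostDet (k : ℕ) : Differentiable ℂ (jostDet b₁ b₂ x₂ k) := by
  have h : Differentiable ℂ fun lam ↦ (cell b₁ b₂ x₂ lam)^[k] ((b₁ : ℂ), -1) :=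
    differentiable_iterate_cell (differentiable_const _) k
  unfold jostDet wronskian
  fun_prop

theorem continuous_jostLeft (hb₁ : b₁ ≠ 0) (hx₀ : 0 < x₂) (hx₁ : x₂ < 1) (k : ℕ) :
    Continuous fun p : ℂ × ℝ ↦ jostLeft b₁ b₂ x₂ k p.1 p.2 :=
  (continuous_sol hb₁ hx₀ hx₁ k).comp
    (f := fun p : ℂ × ℝ ↦ (p.1, ((b₁ : ℂ), (-1 : ℂ)), p.2)) (by fun_prop)

theorem continuous_jostRight (hb₁ : b₁ ≠ 0) (hx₀ : 0 < x₂) (hx₁ : x₂ < 1) (k : ℕ) :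
    Continuous fun p : ℂ × ℝ ↦ jostRight b₁ b₂ x₂ k p.1 p.2 := by
  have h : Continuous fun lam ↦ (cellInv b₁ b₂ x₂ lam)^[k] ((b₁ : ℂ), 1) :=
    (differentiable_iterate_cellInv (differentiable_const _) k).continuous
  exact (continuous_sol hb₁ hx₀ hx₁ k).comp
    (f := fun p : ℂ × ℝ ↦ (p.1, (cellInv b₁ b₂ x₂ p.1)^[k] ((b₁ : ℂ), 1), p.2))
    (continuous_fst.prodMk ((h.comp continuous_fst).prodMk continuous_snd))

theorem layer_leftGoing {b : ℝ} (hb : b ≠ 0) (θ : ℂ) :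
    layer b θ (b, -1) = Complex.exp (-θ * I) • ((b : ℂ), (-1 : ℂ)) := by
  have hb' : (b : ℂ) ≠ 0 := by exact_mod_cast hb
  rw [Complex.exp_mul_I, Complex.cos_neg, Complex.sin_neg]
  ext
  · simp [layer]
    ring
  · simp [layer]
    field_simp

theorem layer_rightGoing {b : ℝ} (hb : b ≠ 0) (θ : ℂ) :
    layer b θ (b, 1) = Complex.exp (θ * I) • ((b : ℂ), (1 : ℂ)) := by
  have hb' : (b : ℂ) ≠ 0 := by exact_mod_cast hb
  rw [Complex.exp_mul_I]
  ext
  · simp [layer]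
    ring
  · simp [layer]
    field_simp
    ring

theorem jostLeft_of_nonpos (hb₁ : b₁ ≠ 0) (hx₀ : 0 < x₂) (k : ℕ) (lam : ℂ) {x : ℝ} (hx : x ≤ 0) :
    jostLeft b₁ b₂ x₂ k lam x = Complex.exp (-(lam * b₁ * x) * I) • ((b₁ : ℂ), (-1 : ℂ)) := by
  rw [jostLeft, sol_of_nonpos hx₀ k lam _ hx, layer_leftGoing hb₁]

theorem jostRight_of_ge (hb₁ : b₁ ≠ 0) (hb₂ : b₂ ≠ 0) (hx₁ : x₂ < 1) (k : ℕ) (lam : ℂ) {x : ℝ}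
    (hx : (k : ℝ) ≤ x) :
    jostRight b₁ b₂ x₂ k lam x
      = Complex.exp (lam * b₁ * (x - k) * I) • ((b₁ : ℂ), (1 : ℂ)) := by
  rw [jostRight, sol_of_ge hx₁ k lam _ hx, iterate_cell_iterate_cellInv hb₁ hb₂,
    layer_rightGoing hb₁]

theorem exists_forall_le_of_continuous {g : ℝ → ℝ} (hg : Continuous g) {a b A B : ℝ}
    (ha : ∀ x ≤ a, g x ≤ A) (hb : ∀ x ≥ b, g x ≤ B) : ∃ C > 0, ∀ x, g x ≤ C := by
  obtain ⟨M, hM⟩ := (isCompact_Icc (a := a) (b := b)).exists_bound_of_continuousOn hg.continuousOn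
  refine ⟨max (max A B) (max M 1), by positivity, fun x ↦ ?_⟩
  rcases le_total x a with h | h
  · exact (ha x h).trans ((le_max_left _ _).trans (le_max_left _ _))
  rcases le_total x b with h' | h'
  · exact ((le_abs_self _).trans (hM x ⟨h, h'⟩)).trans ((le_max_left _ _).trans (le_max_right _ _))
  · exact (hb x h').trans ((le_max_right _ _).trans (le_max_left _ _))

/-- To the left of the structure this is exactly the exponential. To the right both waves are
present, but the growing one has the same rate, and compactness covers the structure itself.
Together with the mirrored bound for `jostRight` it makes Green's kernel decay like `exp (-η |x -
y|)`. -/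
theorem exists_norm_jostLeft_le (hb₁ : 0 < b₁) (hx₀ : 0 < x₂) (hx₁ : x₂ < 1) (k : ℕ)
    {lam : ℂ} (hlam : 0 < lam.im) :
    ∃ C > 0, ∀ x, ‖jostLeft b₁ b₂ x₂ k lam x‖ ≤ C * Real.exp (lam.im * b₁ * x) := by
  have hc : Continuous fun x ↦ jostLeft b₁ b₂ x₂ k lam x :=
    (continuous_jostLeft hb₁.ne' hx₀ hx₁ k).comp (f := fun x : ℝ ↦ (lam, x)) (by fun_prop)
  set w := (cell b₁ b₂ x₂ lam)^[k] ((b₁ : ℂ), (-1 : ℂ)) with hw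
  obtain ⟨C, hC, h⟩ := exists_forall_le_of_continuous
    (g := fun x ↦ ‖jostLeft b₁ b₂ x₂ k lam x‖ * Real.exp (-(lam.im * b₁ * x)))
    (by fun_prop) (a := 0) (b := k) (A := ‖((b₁ : ℂ), (-1 : ℂ))‖)
    (B := (1 + b₁ + b₁⁻¹) * ‖w‖)
    (fun x hx ↦ by
      rw [jostLeft_of_nonpos hb₁.ne' hx₀ k lam hx, norm_smul, Complex.norm_exp]
      refine le_of_eq ?_
      have : (-(lam * b₁ * x) * I).re = lam.im * b₁ * x := by simp
      rw [this, mul_right_comm, ← Real.exp_add, add_neg_cancel, Real.exp_zero, one_mul])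
    (fun x hx ↦ by
      have hkx : (k : ℝ) ≤ x := hx
      rw [jostLeft, sol_of_ge hx₁ k lam _ hx, ← hw, Real.exp_neg, mul_inv_le_iff₀ (Real.exp_pos _)]
      refine (norm_layer_le hb₁ _ _).trans ?_
      gcongr
      have : (lam * b₁ * (x - k)).im = lam.im * b₁ * (x - k) := by
        simp [Complex.mul_im]
      rw [this, abs_of_nonneg (mul_nonneg (by positivity) (by linarith))]
      gcongr
      linarith [k.cast_nonneg (α := ℝ)])
  refine ⟨C, hC, fun x ↦ ?_⟩
  have h1 := h x
  rwa [Real.exp_neg, mul_inv_le_iff₀ (Real.exp_pos _)] at h1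

theorem exists_norm_jostRight_le (hb₁ : 0 < b₁) (hb₂ : 0 < b₂) (hx₀ : 0 < x₂) (hx₁ : x₂ < 1)
    (k : ℕ) {lam : ℂ} (hlam : 0 < lam.im) :
    ∃ C > 0, ∀ x, ‖jostRight b₁ b₂ x₂ k lam x‖ ≤ C * Real.exp (-(lam.im * b₁ * x)) := by
  have hc : Continuous fun x ↦ jostRight b₁ b₂ x₂ k lam x :=
    (continuous_jostRight hb₁.ne' hx₀ hx₁ k).comp (f := fun x : ℝ ↦ (lam, x)) (by fun_prop)
  set w := (cellInv b₁ b₂ x₂ lam)^[k] ((b₁ : ℂ), (1 : ℂ)) with hw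
  obtain ⟨C, hC, h⟩ := exists_forall_le_of_continuous
    (g := fun x ↦ ‖jostRight b₁ b₂ x₂ k lam x‖ * Real.exp (lam.im * b₁ * x))
    (by fun_prop) (a := 0) (b := k) (A := (1 + b₁ + b₁⁻¹) * ‖w‖)
    (B := ‖((b₁ : ℂ), (1 : ℂ))‖ * Real.exp (lam.im * b₁ * k))
    (fun x hx ↦ by
      rw [jostRight, sol_of_nonpos hx₀ k lam _ hx, ← hw, ← neg_neg (lam.im * b₁ * x), Real.exp_neg,
        mul_inv_le_iff₀ (Real.exp_pos _)]
      refine (norm_layer_le hb₁ _ _).trans ?_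
      have : (lam * b₁ * x).im = lam.im * b₁ * x := by
        simp [Complex.mul_im]
      rw [this, abs_of_nonpos (mul_nonpos_of_nonneg_of_nonpos (by positivity) hx)])
    (fun x hx ↦ by
      rw [jostRight_of_ge hb₁.ne' hb₂.ne' hx₁ k lam hx, norm_smul, Complex.norm_exp]
      refine le_of_eq ?_
      have : (lam * b₁ * (x - k) * I).re = -(lam.im * b₁ * (x - k)) := by simp [Complex.mul_im]
      rw [this, mul_right_comm, ← Real.exp_add, mul_comm]
      ring_nf)
  refine ⟨C, hC, fun x ↦ ?_⟩
  have h1 := h x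
  rwa [← neg_neg (lam.im * b₁ * x), Real.exp_neg, mul_inv_le_iff₀ (Real.exp_pos _)] at h1

/-! ### The energy flux -/

/-- The energy flux of a state. -/
def flux (w : ℂ × ℂ) : ℝ := (w.1 * (starRingEnd ℂ) w.2).re

/-- The flux is a difference of squared wave amplitudes. Since layers multiply these amplitudes by
exponentials, monotonicity of the flux can be read off from the sign of `Im θ`. -/
theorem four_mul_flux (b : ℝ) (w : ℂ × ℂ) :
    4 * b * flux w = ‖w.1 + b * w.2‖ ^ 2 - ‖w.1 - b * w.2‖ ^ 2 := by
  rw [← Complex.normSq_eq_norm_sq, ← Complex.normSq_eq_norm_sq, Complex.normSq_apply,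
    Complex.normSq_apply, flux]
  simp
  ring

theorem four_mul_flux_layer {b : ℝ} (hb : b ≠ 0) (θ : ℂ) (w : ℂ × ℂ) :
    4 * b * flux (layer b θ w) = Real.exp (-2 * θ.im) * ‖w.1 + b * w.2‖ ^ 2
      - Real.exp (2 * θ.im) * ‖w.1 - b * w.2‖ ^ 2 := by
  rw [four_mul_flux, layer_add_mul hb, layer_sub_mul hb, norm_mul, norm_mul, mul_pow, mul_pow,
    Complex.norm_exp, Complex.norm_exp, ← Real.exp_nat_mul, ← Real.exp_nat_mul]
  simp

theorem flux_layer_le {b : ℝ} (hb : 0 < b) {θ : ℂ} (hθ : 0 ≤ θ.im) (w : ℂ × ℂ) :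
    flux (layer b θ w) ≤ flux w := by
  have h1 := four_mul_flux_layer hb.ne' θ w
  have h2 := four_mul_flux b w
  have e1 : Real.exp (-2 * θ.im) ≤ 1 := Real.exp_le_one_iff.2 (by linarith)
  have e2 : 1 ≤ Real.exp (2 * θ.im) := Real.one_le_exp (by linarith)
  have n1 := sq_nonneg ‖w.1 + b * w.2‖
  have n2 := sq_nonneg ‖w.1 - b * w.2‖
  have : 4 * b * flux (layer b θ w) ≤ 4 * b * flux w := by
    rw [h1, h2]
    nlinarith
  exact le_of_mul_le_mul_left this (by positivity)

theorem flux_iterate_cell_le (hb₁ : 0 < b₁) (hb₂ : 0 < b₂) (hx₀ : 0 < x₂) (hx₁ : x₂ < 1)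
    {lam : ℂ} (hlam : 0 ≤ lam.im) (k : ℕ) (w : ℂ × ℂ) :
    flux ((cell b₁ b₂ x₂ lam)^[k] w) ≤ flux w := by
  induction k with
  | zero => exact le_rfl
  | succ k ih =>
    rw [Function.iterate_succ_apply', cell]
    refine (flux_layer_le hb₁ ?_ _).trans ((flux_layer_le hb₂ ?_ _).trans ih)
    · have : (lam * b₁ * (1 - x₂)).im = lam.im * b₁ * (1 - x₂) := by simp [Complex.mul_im]
      rw [this]
      have : 0 < 1 - x₂ := by linarith
      positivity
    · have : (lam * b₂ * x₂).im = lam.im * b₂ * x₂ := by simp [Complex.mul_im]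
      rw [this]
      positivity

/-- A zero would turn the incoming state `(b₁, -1)`, of flux `-b₁ < 0`, into a multiple of `(b₁,
1)`, of nonnegative flux, whereas for `Im lam ≥ 0` the flux cannot increase. -/
theorem jostDet_ne_zero (hb₁ : 0 < b₁) (hb₂ : 0 < b₂) (hx₀ : 0 < x₂) (hx₁ : x₂ < 1)
    {lam : ℂ} (hlam : 0 ≤ lam.im) (k : ℕ) : jostDet b₁ b₂ x₂ k lam ≠ 0 := by
  intro h
  have h1 := flux_iterate_cell_le hb₁ hb₂ hx₀ hx₁ hlam k ((b₁ : ℂ), (-1 : ℂ))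
  rw [jostDet, wronskian] at h
  generalize (cell b₁ b₂ x₂ lam)^[k] ((b₁ : ℂ), (-1 : ℂ)) = w at *
  have h2 : w.1 = b₁ * w.2 := by linear_combination h
  have h3 : flux w = b₁ * ‖w.2‖ ^ 2 := by
    rw [flux, h2, mul_assoc, Complex.mul_conj, Complex.normSq_eq_norm_sq]
    norm_cast
  have h4 : flux ((b₁ : ℂ), (-1 : ℂ)) = -b₁ := by simp [flux]
  rw [h3, h4] at h1
  nlinarith [mul_nonneg hb₁.le (sq_nonneg ‖w.2‖)]

end

/-! ### Kernels of Green's function type -/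

/-- The kernel `f(x) r(y)` for `x ≤ y` and `g(x) l(y)` for `y < x`. -/
def splitKernel (f g l r : ℝ → ℂ) (x y : ℝ) : ℂ :=
  if x ≤ y then f x * r y else g x * l y

theorem measurable_splitKernel {f g l r : ℝ → ℂ} (hf : Measurable f) (hg : Measurable g)
    (hl : Measurable l) (hr : Measurable r) :
    Measurable (Function.uncurry (splitKernel f g l r)) :=
  Measurable.ite (measurableSet_le measurable_fst measurable_snd)
    ((hf.comp measurable_fst).mul (hr.comp measurable_snd))
    ((hg.comp measurable_fst).mul (hl.comp measurable_snd))

theorem lintegral_exp_neg_abs_lt_top {η C : ℝ} (hη : 0 < η) :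
    ∫⁻ t : ℝ, ENNReal.ofReal (C * Real.exp (-(η * |t|))) < ⊤ := by
  have h1 : IntegrableOn (fun t : ℝ ↦ Real.exp (-(η * |t|))) (Ioi 0) :=
    (integrableOn_exp_mul_Ioi (neg_lt_zero.2 hη) 0).congr_fun
      (fun t ht ↦ by simp [abs_of_pos (mem_Ioi.1 ht)]) measurableSet_Ioi
  have h2 : IntegrableOn (fun t : ℝ ↦ Real.exp (-(η * |t|))) (Iic 0) :=
    (integrableOn_exp_mul_Iic hη 0).congr_fun
      (fun t ht ↦ by simp [abs_of_nonpos (mem_Iic.1 ht)]) measurableSet_Iic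
  have h : Integrable (fun t : ℝ ↦ Real.exp (-(η * |t|))) := by
    rw [← integrableOn_univ, ← Iic_union_Ioi (a := (0 : ℝ))]
    exact h2.union h1
  exact (h.const_mul C).lintegral_lt_top

/-- On each side of the diagonal the growing factor is taken at the smaller argument and the
decaying one at the larger. The product is bounded by `C² exp (-η |x - y|)`, whose integral in
either variable is a fixed number. -/
theorem exists_isSchurKernel_splitKernel {f g l r : ℝ → ℂ} (hf : Measurable f)
    (hg : Measurable g) (hl : Measurable l) (hr : Measurable r) {C η : ℝ} (hC : 0 ≤ C)
    (hη : 0 < η) (hfC : ∀ x, ‖f x‖ ≤ C * Real.exp (η * x))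
    (hgC : ∀ x, ‖g x‖ ≤ C * Real.exp (-(η * x))) (hlC : ∀ x, ‖l x‖ ≤ C * Real.exp (η * x))
    (hrC : ∀ x, ‖r x‖ ≤ C * Real.exp (-(η * x))) :
    ∃ A : ℝ≥0, IsSchurKernel (splitKernel f g l r) A := by
  have hb : ∀ x y, ‖splitKernel f g l r x y‖ ≤ C ^ 2 * Real.exp (-(η * |x - y|)) := by
    intro x y
    rw [splitKernel]
    split_ifs with h
    · rw [norm_mul, abs_of_nonpos (by linarith)]
      refine (mul_le_mul (hfC x) (hrC y) (norm_nonneg _) (by positivity)).trans (le_of_eq ?_)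
      rw [mul_mul_mul_comm, ← Real.exp_add]
      ring_nf
    · rw [norm_mul, abs_of_nonneg (by linarith)]
      refine (mul_le_mul (hgC x) (hlC y) (norm_nonneg _) (by positivity)).trans (le_of_eq ?_)
      rw [mul_mul_mul_comm, ← Real.exp_add]
      ring_nf
  have hb' : ∀ x y, ‖splitKernel f g l r x y‖ₑ ≤
      ENNReal.ofReal (C ^ 2 * Real.exp (-(η * |x - y|))) := fun x y ↦ by
    rw [← ofReal_norm]
    exact ENNReal.ofReal_le_ofReal (hb x y)
  have hfin := lintegral_exp_neg_abs_lt_top (C := C ^ 2) hη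
  refine ⟨(∫⁻ t : ℝ, ENNReal.ofReal (C ^ 2 * Real.exp (-(η * |t|)))).toNNReal,
    measurable_splitKernel hf hg hl hr, fun x ↦ ?_, fun y ↦ ?_⟩
  · rw [ENNReal.coe_toNNReal hfin.ne]
    refine (lintegral_mono (hb' x)).trans (le_of_eq ?_)
    exact lintegral_sub_left_eq_self
      (fun t ↦ ENNReal.ofReal (C ^ 2 * Real.exp (-(η * |t|)))) x
  · rw [ENNReal.coe_toNNReal hfin.ne]
    refine (lintegral_mono fun x ↦ hb' x y).trans (le_of_eq ?_)
    exact lintegral_sub_right_eq_self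
      (fun t ↦ ENNReal.ofReal (C ^ 2 * Real.exp (-(η * |t|)))) y

/-- Weak differentiation of an operator with a kernel of Green's function type whose jump on the
diagonal is the constant `-j`. -/
theorem integral_splitKernel_mul_deriv {f g f' g' l r : ℝ → ℂ} {A A' : ℝ≥0}
    {L L' : L2R →L[ℂ] L2R} (hK : IsSchurKernel (splitKernel f g l r) A)
    (hK' : IsSchurKernel (splitKernel f' g' l r) A') (hL : HasKernel L (splitKernel f g l r))
    (hL' : HasKernel L' (splitKernel f' g' l r)) {s : Set ℝ} (hs : s.Countable)
    (hf : Continuous f) (hg : Continuous g) (hf' : LocallyIntegrable f' volume)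
    (hg' : LocallyIntegrable g' volume) (hfd : ∀ x ∉ s, HasDerivAt f (f' x) x)
    (hgd : ∀ x ∉ s, HasDerivAt g (g' x) x) {j : ℂ} (hj : ∀ y, f y * r y - g y * l y = j)
    (v : L2R) {φ : ℝ → ℂ} (hφ : ContDiff ℝ ∞ φ) (hφc : HasCompactSupport φ) :
    ∫ x, L v x * deriv φ x = j * (∫ x, v x * φ x) - ∫ x, L' v x * φ x := by
  have hφd : Continuous (deriv φ) := hφ.continuous_deriv (by norm_num)
  have hφ2 : MemLp φ 2 volume := hφ.continuous.memLp_of_hasCompactSupport hφc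
  have hφd2 : MemLp (deriv φ) 2 volume := hφd.memLp_of_hasCompactSupport hφc.deriv
  have hvφ : Integrable fun y ↦ v y * φ y := by
    simpa only [smul_eq_mul] using
      (locallyIntegrable_L2R v).integrable_smul_right_of_hasCompactSupport hφ.continuous hφc
  have hi : Integrable fun y ↦ (∫ x, splitKernel f' g' l r x y * φ x) * v y := by
    have h := (hK'.integrable_prod v hφ.continuous.measurable hφ2).integral_prod_right
    refine h.congr (.of_forall fun y ↦ ?_)
    simp only
    rw [← integral_mul_const]
    congr 1
    ext x
    ring
  rw [hK.integral_apply_mul hL v hφd.measurable hφd2,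
    hK'.integral_apply_mul hL' v hφ.continuous.measurable hφ2, ← integral_const_mul,
    ← integral_sub (hvφ.const_mul j) hi]
  refine integral_congr_ae (.of_forall fun y ↦ ?_)
  have hmul : ∀ {p : ℝ → ℂ} (c : ℂ), LocallyIntegrable p volume →
      LocallyIntegrable (fun x ↦ p x * c) volume := fun {p} c hp ↦ by
    simpa [Pi.smul_def, mul_comm] using hp.smul c
  have h := integral_ite_mul_deriv (f := fun x ↦ f x * r y) (g := fun x ↦ g x * l y) hs
    (hf.mul continuous_const) (hg.mul continuous_const)
    (hmul (r y) hf') (hmul (l y) hg') (fun x hx ↦ (hfd x hx).mul_const (r y))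
    (fun x hx ↦ (hgd x hx).mul_const (l y)) hφ hφc y
  simp only [splitKernel]
  rw [h, hj]
  ring

/-! ### The resolvent in the upper half plane -/

theorem HasWeakDeriv.sub {u w u' w' : L2R} (h : HasWeakDeriv u w) (h' : HasWeakDeriv u' w') :
    HasWeakDeriv (u - u') (w - w') := by
  intro φ hφ hφc
  have hφd : Continuous (deriv φ) := hφ.continuous_deriv (by norm_num)
  have hint : ∀ (v : L2R) {ψ : ℝ → ℂ}, Continuous ψ → HasCompactSupport ψ →
      Integrable fun x ↦ v x * ψ x := fun v ψ hψ hψc ↦ by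
    simpa only [smul_eq_mul] using
      (locallyIntegrable_L2R v).integrable_smul_right_of_hasCompactSupport hψ hψc
  have hsub : ∀ (v v' : L2R) {ψ : ℝ → ℂ}, Continuous ψ → HasCompactSupport ψ →
      ∫ x, (v - v') x * ψ x = (∫ x, v x * ψ x) - ∫ x, v' x * ψ x := fun v v' ψ hψ hψc ↦ by
    rw [← integral_sub (hint v hψ hψc) (hint v' hψ hψc)]
    refine integral_congr_ae ?_
    filter_upwards [Lp.coeFn_sub v v'] with x hx
    rw [hx, Pi.sub_apply, sub_mul]
  rw [hsub u u' hφd hφc.deriv, hsub w w' hφ.continuous hφc, h φ hφ hφc, h' φ hφ hφc]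
  ring

theorem OperatorGraph.sub {a : ℝ → ℝ} {u f u' f' : L2R} (h : OperatorGraph a u f)
    (h' : OperatorGraph a u' f') : OperatorGraph a (u - u') (f - f') := by
  obtain ⟨w, q, h1, h2, h3⟩ := h
  obtain ⟨w', q', h1', h2', h3'⟩ := h'
  refine ⟨w - w', q - q', h1.sub h1', ?_, ?_⟩
  · filter_upwards [h2, h2', Lp.coeFn_sub w w', Lp.coeFn_sub q q'] with x e1 e2 e3 e4
    rw [e3, e4, Pi.sub_apply, Pi.sub_apply, e1, e2, mul_sub]
  · have := h3.sub h3'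
    rwa [show -f - -f' = -(f - f') by abel] at this

section

variable {b₁ b₂ x₂ : ℝ}

theorem truncatedCoeff_eq_or (k : ℕ) (x : ℝ) :
    truncatedCoeff b₁ b₂ x₂ k x = (b₁ ^ 2)⁻¹ ∨ truncatedCoeff b₁ b₂ x₂ k x = (b₂ ^ 2)⁻¹ := by
  unfold truncatedCoeff periodicCoeff cellCoeff
  split_ifs <;> simp

theorem truncatedCoeff_ne_zero (hb₁ : b₁ ≠ 0) (hb₂ : b₂ ≠ 0) (k : ℕ) (x : ℝ) :
    (truncatedCoeff b₁ b₂ x₂ k x : ℂ) ≠ 0 := by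
  rcases truncatedCoeff_eq_or (b₁ := b₁) (b₂ := b₂) (x₂ := x₂) k x with h | h <;> rw [h] <;>
    simp [hb₁, hb₂]

theorem norm_inv_truncatedCoeff_le (k : ℕ) (x : ℝ) :
    ‖(truncatedCoeff b₁ b₂ x₂ k x : ℂ)⁻¹‖ ≤ b₁ ^ 2 + b₂ ^ 2 := by
  rcases truncatedCoeff_eq_or (b₁ := b₁) (b₂ := b₂) (x₂ := x₂) k x with h | h <;> rw [h] <;>
    simp <;> positivity

theorem measurable_truncatedCoeff (k : ℕ) : Measurable (truncatedCoeff b₁ b₂ x₂ k) := by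
  refine Measurable.ite measurableSet_Icc ?_ measurable_const
  exact (Measurable.ite measurableSet_Iio measurable_const measurable_const).comp measurable_fract

theorem measurable_inv_truncatedCoeff (k : ℕ) :
    Measurable fun x ↦ (truncatedCoeff b₁ b₂ x₂ k x : ℂ)⁻¹ :=
  (Complex.measurable_ofReal.comp (measurable_truncatedCoeff k)).inv

theorem locallyIntegrable_inv_truncatedCoeff_mul (k : ℕ) {g : ℝ → ℂ} (hg : Continuous g) :
    LocallyIntegrable (fun x ↦ (truncatedCoeff b₁ b₂ x₂ k x : ℂ)⁻¹ * g x) volume := by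
  have hc : Continuous fun x ↦ ((b₁ ^ 2 + b₂ ^ 2 : ℝ) : ℂ) * g x := by fun_prop
  refine hc.locallyIntegrable.mono
    ((measurable_inv_truncatedCoeff k).mul hg.measurable).aestronglyMeasurable
    (.of_forall fun x ↦ ?_)
  rw [norm_mul, norm_mul]
  gcongr
  refine (norm_inv_truncatedCoeff_le k x).trans ?_
  rw [Complex.norm_real]
  exact le_abs_self _

/-- The kernel `u₋(min) u₊(max)` built from the Jost solutions. -/
def greenKernel (b₁ b₂ x₂ : ℝ) (k : ℕ) (lam : ℂ) : ℝ → ℝ → ℂ :=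
  splitKernel (fun x ↦ (jostLeft b₁ b₂ x₂ k lam x).1) (fun x ↦ (jostRight b₁ b₂ x₂ k lam x).1)
    (fun x ↦ (jostLeft b₁ b₂ x₂ k lam x).1) (fun x ↦ (jostRight b₁ b₂ x₂ k lam x).1)

theorem eq_zero_of_memLp_restrict {S : Set ℝ} (hS : volume S = ⊤) {c : ℂ}
    (h : MemLp (fun _ : ℝ ↦ c) 2 (volume.restrict S)) : c = 0 := by
  rw [memLp_const_iff (by norm_num) (by norm_num)] at h
  refine h.resolve_right ?_
  simp [hS]

theorem eq_of_hasDerivAt_zero_off_countable {F : ℝ → ℂ} {s : Set ℝ} (hs : s.Countable)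
    (hc : Continuous F) (hd : ∀ x ∉ s, HasDerivAt F 0 x) (x y : ℝ) : F x = F y := by
  have h := integral_eq_of_hasDerivAt_off_countable F (fun _ ↦ 0) (a := y) (b := x) hs
    hc.continuousOn (fun z hz ↦ hd z hz.2) (by simp)
  simp only [intervalIntegral.integral_zero] at h
  exact (sub_eq_zero.1 h.symm)

/-- There are no square integrable eigenfunctions for `Im lam > 0`. -/
theorem eq_zero_of_operatorGraph (hb₁ : 0 < b₁) (hb₂ : 0 < b₂) (hx₀ : 0 < x₂) (hx₁ : x₂ < 1)
    (k : ℕ) {lam : ℂ} (hlam : 0 < lam.im) {u : L2R}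
    (h : OperatorGraph (truncatedCoeff b₁ b₂ x₂ k) u (lam ^ 2 • u)) : u = 0 := by
  have hlam0 : lam ≠ 0 := by
    rintro rfl
    simp at hlam
  obtain ⟨w, q, hu, hq, hq'⟩ := h
  obtain ⟨s, hs, hsol⟩ := exists_countable_hasDerivAt_sol hb₁.ne' hb₂.ne' hx₀ hx₁ k
  obtain ⟨c₁, h1⟩ := hu.exists_ae_eq_primitive
  obtain ⟨c₂, h2⟩ := hq'.exists_ae_eq_primitive
  set U : ℝ → ℂ := fun x ↦ c₁ + ∫ t in (0 : ℝ)..x, w t with hU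
  set Q : ℝ → ℂ := fun x ↦ c₂ + ∫ t in (0 : ℝ)..x, (-(lam ^ 2 • u) : L2R) t with hQ
  replace h1 : ∀ᵐ x : ℝ, u x = U x := h1
  replace h2 : ∀ᵐ x : ℝ, q x = Q x := h2
  have hUc : Continuous U := continuous_const.add (continuous_primitive_L2R w)
  have hQc : Continuous Q := continuous_const.add (continuous_primitive_L2R _)
  have hw : ∀ᵐ x : ℝ, w x = (truncatedCoeff b₁ b₂ x₂ k x : ℂ)⁻¹ * Q x := by
    filter_upwards [hq, h2] with x e1 e2
    rw [← e2, e1, inv_mul_cancel_left₀ (truncatedCoeff_ne_zero hb₁.ne' hb₂.ne' k x)]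
  have hf : ∀ᵐ x : ℝ, (-(lam ^ 2 • u) : L2R) x = -(lam ^ 2) * U x := by
    filter_upwards [h1, Lp.coeFn_neg (lam ^ 2 • u), Lp.coeFn_smul (lam ^ 2) u] with x e1 e2 e3
    rw [e2, Pi.neg_apply, e3, Pi.smul_apply, e1, smul_eq_mul, neg_mul]
  have hcongr : ∀ {p p' : ℝ → ℂ}, (∀ᵐ x : ℝ, p x = p' x) → ∀ x,
      ∫ t in (0 : ℝ)..x, p t = ∫ t in (0 : ℝ)..x, p' t := fun hp x ↦
    intervalIntegral.integral_congr_ae (hp.mono fun t ht _ ↦ ht)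
  have hUd : ∀ x ∉ s, HasDerivAt U ((truncatedCoeff b₁ b₂ x₂ k x : ℂ)⁻¹ * Q x) x := by
    intro x hx
    have hl := locallyIntegrable_inv_truncatedCoeff_mul (b₁ := b₁) (b₂ := b₂) (x₂ := x₂) k hQc
    have hU' : U = fun x ↦ c₁ + ∫ t in (0 : ℝ)..x,
        (truncatedCoeff b₁ b₂ x₂ k t : ℂ)⁻¹ * Q t := funext fun x ↦ congrArg (c₁ + ·) (hcongr hw x)
    rw [hU']
    refine HasDerivAt.const_add _ (intervalIntegral.integral_hasDerivAt_right
      (hl.integrableOn_isCompact isCompact_uIcc).intervalIntegrable ?_ ?_)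
    · exact ((measurable_inv_truncatedCoeff k).mul
        hQc.measurable).stronglyMeasurable.stronglyMeasurableAtFilter
    -- Off `s` the coefficient is locally constant, so the integrand is continuous at `x` and the
    -- primitive is differentiable there.
    · have he : (fun t ↦ (truncatedCoeff b₁ b₂ x₂ k x : ℂ)⁻¹ * Q t) =ᶠ[𝓝 x]
          fun t ↦ (truncatedCoeff b₁ b₂ x₂ k t : ℂ)⁻¹ * Q t := by
        filter_upwards [(hsol x hx).1] with t ht
        rw [ht]
      exact (continuousAt_const.mul hQc.continuousAt).congr he
  have hQd : ∀ x, HasDerivAt Q (-(lam ^ 2) * U x) x := by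
    intro x
    have hQ' : Q = fun x ↦ c₂ + ∫ t in (0 : ℝ)..x, -(lam ^ 2) * U t :=
      funext fun x ↦ congrArg (c₂ + ·) (hcongr hf x)
    rw [hQ']
    exact ((continuous_const.mul hUc).integral_hasStrictDerivAt 0 x).hasDerivAt.const_add _
  -- This is `i lam` times the Wronskian of the state `(U, Q / (i lam))` with a solution of the same
  -- system, hence constant.
  have hconst : ∀ z : ℂ × ℂ, ∃ κ : ℂ, ∀ x,
      I * lam * U x * (sol b₁ b₂ x₂ k lam z x).2 - (sol b₁ b₂ x₂ k lam z x).1 * Q x = κ := by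
    intro z
    have hc : Continuous fun x ↦ sol b₁ b₂ x₂ k lam z x :=
      (continuous_sol hb₁.ne' hx₀ hx₁ k).comp (f := fun x : ℝ ↦ (lam, z, x)) (by fun_prop)
    refine ⟨_, fun x ↦ eq_of_hasDerivAt_zero_off_countable
      (F := fun x ↦ I * lam * U x * (sol b₁ b₂ x₂ k lam z x).2 -
        (sol b₁ b₂ x₂ k lam z x).1 * Q x) hs (by fun_prop) (fun x hx ↦ ?_) x 0⟩
    obtain ⟨d1, d2⟩ := (hsol x hx).2 lam z
    refine ((((hUd x hx).const_mul (I * lam)).mul d2).sub (d1.mul (hQd x))).congr_deriv ?_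
    linear_combination (lam ^ 2 * U x * (sol b₁ b₂ x₂ k lam z x).1) * Complex.I_mul_I
  have hmem : MemLp (fun x ↦ ‖U x‖ + ‖Q x‖) 2 volume := by
    have hU2 : MemLp U 2 volume := (memLp_congr_ae h1).1 (Lp.memLp u)
    have hQ2 : MemLp Q 2 volume := (memLp_congr_ae h2).1 (Lp.memLp q)
    exact hU2.norm.add hQ2.norm
  -- A constant dominated by a square integrable function on a set of infinite measure vanishes. It
  -- is used on the half line where the Jost solution in question is bounded.
  have hzero : ∀ {S : Set ℝ}, MeasurableSet S → volume S = ⊤ → ∀ {Z : ℝ → ℂ × ℂ} {C : ℝ},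
      (∀ x ∈ S, ‖Z x‖ ≤ C) → ∀ {κ : ℂ},
      (∀ x, I * lam * U x * (Z x).2 - (Z x).1 * Q x = κ) → κ = 0 := by
    intro S hSm hS Z C hZ κ hκ
    refine eq_zero_of_memLp_restrict hS ((hmem.restrict S).of_le_mul (c := (‖lam‖ + 1) * C)
      aestronglyMeasurable_const ?_)
    filter_upwards [ae_restrict_mem hSm] with x hx
    have hC : 0 ≤ C := (norm_nonneg _).trans (hZ x hx)
    rw [← hκ x, Real.norm_of_nonneg (by positivity)]
    refine (norm_sub_le _ _).trans ?_
    rw [norm_mul, norm_mul, norm_mul, norm_mul, Complex.norm_I, one_mul]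
    have z1 := (norm_fst_le (Z x)).trans (hZ x hx)
    have z2 := (norm_snd_le (Z x)).trans (hZ x hx)
    calc ‖lam‖ * ‖U x‖ * ‖(Z x).2‖ + ‖(Z x).1‖ * ‖Q x‖
        ≤ ‖lam‖ * ‖U x‖ * C + C * ‖Q x‖ := by gcongr
      _ ≤ ‖lam‖ * ‖U x‖ * C + C * ‖Q x‖ + (‖lam‖ * C * ‖Q x‖ + C * ‖U x‖) :=
          le_add_of_nonneg_right (by positivity)
      _ = (‖lam‖ + 1) * C * (‖U x‖ + ‖Q x‖) := by ring
  have hη : 0 < lam.im * b₁ := by positivity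
  obtain ⟨κl, hl⟩ := hconst (b₁, -1)
  obtain ⟨κr, hr⟩ := hconst ((cellInv b₁ b₂ x₂ lam)^[k] (b₁, 1))
  obtain ⟨Cl, hCl0, hCl⟩ := exists_norm_jostLeft_le (b₂ := b₂) hb₁ hx₀ hx₁ k hlam
  obtain ⟨Cr, hCr0, hCr⟩ := exists_norm_jostRight_le hb₁ hb₂ hx₀ hx₁ k hlam
  have hκl : κl = 0 := by
    refine hzero (S := Iic 0) measurableSet_Iic (by simp) (C := Cl) (fun x hx ↦ ?_) hl
    refine (hCl x).trans (mul_le_of_le_one_right hCl0.le (Real.exp_le_one_iff.2 ?_))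
    exact mul_nonpos_of_nonneg_of_nonpos hη.le hx
  have hκr : κr = 0 := by
    refine hzero (S := Ici 0) measurableSet_Ici (by simp) (C := Cr) (fun x hx ↦ ?_) hr
    refine (hCr x).trans (mul_le_of_le_one_right hCr0.le (Real.exp_le_one_iff.2 ?_))
    exact neg_nonpos.2 (mul_nonneg hη.le hx)
  have hD := jostDet_ne_zero hb₁ hb₂ hx₀ hx₁ hlam.le k
  -- Both Wronskians vanish; eliminating `Q` between the two equations leaves `i lam D U = 0`.
  have hU0 : ∀ x, U x = 0 := by
    intro x
    have e1 := hl x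
    have e2 := hr x
    have e3 := wronskian_jost (x₂ := x₂) hb₁.ne' hb₂.ne' k lam x
    rw [wronskian, jostLeft, jostRight] at e3
    rw [hκl] at e1
    rw [hκr] at e2
    have : I * lam * jostDet b₁ b₂ x₂ k lam * U x = 0 := by
      rw [← e3]
      linear_combination (sol b₁ b₂ x₂ k lam (b₁, -1) x).1 * e2 -
        (sol b₁ b₂ x₂ k lam ((cellInv b₁ b₂ x₂ lam)^[k] (b₁, 1)) x).1 * e1
    exact (mul_eq_zero.1 this).resolve_left (mul_ne_zero (mul_ne_zero Complex.I_ne_zero hlam0) hD)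
  refine Lp.ext ?_
  filter_upwards [h1, Lp.coeFn_zero ℂ 2 (volume : Measure ℝ)] with x e1 e2
  rw [e1, e2, hU0 x, Pi.zero_apply]

/-- In the upper half plane the resolvent is the integral operator with Green's kernel. -/
theorem exists_isResolventAt (hb₁ : 0 < b₁) (hb₂ : 0 < b₂) (hx₀ : 0 < x₂) (hx₁ : x₂ < 1)
    (k : ℕ) {lam : ℂ} (hlam : 0 < lam.im) :
    ∃ (R G : L2R →L[ℂ] L2R) (A : ℝ≥0), IsResolventAt (truncatedCoeff b₁ b₂ x₂ k) lam R ∧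
      R = (I / (lam * jostDet b₁ b₂ x₂ k lam)) • G ∧
      IsSchurKernel (greenKernel b₁ b₂ x₂ k lam) A ∧
      HasKernel G (greenKernel b₁ b₂ x₂ k lam) := by
  have hlam0 : lam ≠ 0 := by
    rintro rfl
    simp at hlam
  have hη : 0 < lam.im * b₁ := by positivity
  have hD := jostDet_ne_zero hb₁ hb₂ hx₀ hx₁ hlam.le k
  set D := jostDet b₁ b₂ x₂ k lam with hDdef
  obtain ⟨s, hs, hsol⟩ := exists_countable_hasDerivAt_sol hb₁.ne' hb₂.ne' hx₀ hx₁ k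
  obtain ⟨Cl, hCl0, hCl⟩ := exists_norm_jostLeft_le (b₂ := b₂) hb₁ hx₀ hx₁ k hlam
  obtain ⟨Cr, hCr0, hCr⟩ := exists_norm_jostRight_le hb₁ hb₂ hx₀ hx₁ k hlam
  have hlc : Continuous fun x ↦ jostLeft b₁ b₂ x₂ k lam x :=
    (continuous_jostLeft hb₁.ne' hx₀ hx₁ k).comp (f := fun x : ℝ ↦ (lam, x)) (by fun_prop)
  have hrc : Continuous fun x ↦ jostRight b₁ b₂ x₂ k lam x :=
    (continuous_jostRight hb₁.ne' hx₀ hx₁ k).comp (f := fun x : ℝ ↦ (lam, x)) (by fun_prop)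
  set a := truncatedCoeff b₁ b₂ x₂ k with ha
  set ul : ℝ → ℂ := fun x ↦ (jostLeft b₁ b₂ x₂ k lam x).1 with hul
  set vl : ℝ → ℂ := fun x ↦ (jostLeft b₁ b₂ x₂ k lam x).2 with hvl
  set ur : ℝ → ℂ := fun x ↦ (jostRight b₁ b₂ x₂ k lam x).1 with hur
  set vr : ℝ → ℂ := fun x ↦ (jostRight b₁ b₂ x₂ k lam x).2 with hvr
  have hulc : Continuous ul := hlc.fst
  have hvlc : Continuous vl := hlc.snd
  have hurc : Continuous ur := hrc.fst
  have hvrc : Continuous vr := hrc.snd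
  set B : ℝ := b₁ ^ 2 + b₂ ^ 2 with hB
  have hB0 : 0 < B := by positivity
  set C : ℝ := (1 + ‖lam‖ * B) * (Cl + Cr) with hC
  have hC0 : 0 ≤ C := by positivity
  have hClC : Cl ≤ C := by
    have : 0 ≤ ‖lam‖ * B * (Cl + Cr) := by positivity
    rw [hC]
    linarith
  have hCrC : Cr ≤ C := by
    have : 0 ≤ ‖lam‖ * B * (Cl + Cr) := by positivity
    rw [hC]
    linarith
  have hul_le : ∀ x, ‖ul x‖ ≤ Cl * Real.exp (lam.im * b₁ * x) := fun x ↦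
    (norm_fst_le _).trans (hCl x)
  have hvl_le : ∀ x, ‖vl x‖ ≤ Cl * Real.exp (lam.im * b₁ * x) := fun x ↦
    (norm_snd_le _).trans (hCl x)
  have hur_le : ∀ x, ‖ur x‖ ≤ Cr * Real.exp (-(lam.im * b₁ * x)) := fun x ↦
    (norm_fst_le _).trans (hCr x)
  have hvr_le : ∀ x, ‖vr x‖ ≤ Cr * Real.exp (-(lam.im * b₁ * x)) := fun x ↦
    (norm_snd_le _).trans (hCr x)
  have hderiv_le : ∀ {p : ℝ → ℂ} {M E : ℝ} {x : ℝ}, ‖p x‖ ≤ M * E → 0 ≤ E → 0 ≤ M →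
      M ≤ Cl + Cr → ‖I * lam * ((a x : ℂ)⁻¹ * p x)‖ ≤ C * E := by
    intro p M E x hp hE hM hMC
    rw [norm_mul, norm_mul, norm_mul, Complex.norm_I, one_mul]
    calc ‖lam‖ * (‖(a x : ℂ)⁻¹‖ * ‖p x‖) ≤ ‖lam‖ * (B * ((Cl + Cr) * E)) := by
          gcongr
          · exact norm_inv_truncatedCoeff_le k x
          · exact hp.trans (by gcongr)
      _ ≤ ‖lam‖ * (B * ((Cl + Cr) * E)) + (Cl + Cr) * E :=
          le_add_of_nonneg_right (by positivity)
      _ = C * E := by rw [hC]; ring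
  set ul' : ℝ → ℂ := fun x ↦ I * lam * ((a x : ℂ)⁻¹ * vl x) with hul'
  set ur' : ℝ → ℂ := fun x ↦ I * lam * ((a x : ℂ)⁻¹ * vr x) with hur'
  have ham : Measurable fun x ↦ (a x : ℂ)⁻¹ := measurable_inv_truncatedCoeff k
  have hwk : ∀ {p : ℝ → ℂ} {M E : ℝ} {x : ℝ}, ‖p x‖ ≤ M * E → 0 ≤ E → M ≤ C →
      ‖p x‖ ≤ C * E := fun hp hE hM ↦ hp.trans (by gcongr)
  have l1 := fun x ↦ hwk (hul_le x) (Real.exp_pos _).le hClC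
  have l2 := fun x ↦ hwk (hur_le x) (Real.exp_pos _).le hCrC
  -- Three kernels share the factors in `y` and carry, as functions of `x`, the solutions `u`, their
  -- companions `v`, and the derivatives `u' = i lam a⁻¹ v`. They represent, up to constants, the
  -- resolvent applied to `f`, its flux `a ∂ₓ`, and its derivative.
  obtain ⟨AU, hU⟩ := exists_isSchurKernel_splitKernel hulc.measurable hurc.measurable
    hulc.measurable hurc.measurable hC0 hη l1 l2 l1 l2
  obtain ⟨AV, hV⟩ := exists_isSchurKernel_splitKernel hvlc.measurable hvrc.measurable
    hulc.measurable hurc.measurable hC0 hη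
    (fun x ↦ hwk (hvl_le x) (Real.exp_pos _).le hClC)
    (fun x ↦ hwk (hvr_le x) (Real.exp_pos _).le hCrC) l1 l2
  obtain ⟨AW, hW⟩ := exists_isSchurKernel_splitKernel (f := ul') (g := ur')
    ((ham.mul hvlc.measurable).const_mul _) ((ham.mul hvrc.measurable).const_mul _)
    hulc.measurable hurc.measurable hC0 hη
    (fun x ↦ hderiv_le (hvl_le x) (Real.exp_pos _).le hCl0.le (by linarith))
    (fun x ↦ hderiv_le (hvr_le x) (Real.exp_pos _).le hCr0.le (by linarith)) l1 l2
  obtain ⟨G, hG⟩ := hU.exists_hasKernel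
  obtain ⟨V, hVk⟩ := hV.exists_hasKernel
  obtain ⟨W, hWk⟩ := hW.exists_hasKernel
  have hV'k : HasKernel ((I * lam) • G)
      (splitKernel (fun x ↦ I * lam * ul x) (fun x ↦ I * lam * ur x) ul ur) := by
    have h := hG.const_smul (I * lam)
    convert h using 3 with x y
    simp only [splitKernel]
    split_ifs <;> ring
  obtain ⟨AV', hV'⟩ : ∃ A, IsSchurKernel
      (splitKernel (fun x ↦ I * lam * ul x) (fun x ↦ I * lam * ur x) ul ur) A := by
    have hle : ∀ {p : ℝ → ℂ} {M E : ℝ} {x : ℝ}, ‖p x‖ ≤ M * E →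
        ‖I * lam * p x‖ ≤ ‖lam‖ * M * E := fun hp ↦ by
      rw [norm_mul, norm_mul, Complex.norm_I, one_mul, mul_assoc]
      gcongr
    have hmax : ∀ {p : ℝ → ℂ} {E : ℝ} {x : ℝ}, ‖p x‖ ≤ C * E → 0 ≤ E →
        ‖I * lam * p x‖ ≤ (‖lam‖ * C + C) * E ∧ ‖p x‖ ≤ (‖lam‖ * C + C) * E := by
      intro p E x hp hE
      have h1 : 0 ≤ C * E := by positivity
      have h2 : 0 ≤ ‖lam‖ * C * E := by positivity
      exact ⟨(hle hp).trans (by nlinarith), hp.trans (by nlinarith)⟩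
    exact exists_isSchurKernel_splitKernel (hulc.measurable.const_mul _)
      (hurc.measurable.const_mul _) hulc.measurable hurc.measurable
      (C := ‖lam‖ * C + C) (by positivity) hη
      (fun x ↦ (hmax (l1 x) (Real.exp_pos _).le).1) (fun x ↦ (hmax (l2 x) (Real.exp_pos _).le).1)
      (fun x ↦ (hmax (l1 x) (Real.exp_pos _).le).2) (fun x ↦ (hmax (l2 x) (Real.exp_pos _).le).2)
  -- The kernel of `u` is continuous across the diagonal, while that of `v` jumps by `D`. The choice
  -- of `c` gives `i lam c D = -1`, so the jump produces exactly the term `-f`.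
  set c : ℂ := I / (lam * D) with hc
  refine ⟨c • G, G, AU, ?_, rfl, hU, hG⟩
  have hloc : ∀ {p : ℝ → ℂ}, Continuous p →
      LocallyIntegrable (fun x ↦ I * lam * ((a x : ℂ)⁻¹ * p x)) volume := fun hp ↦ by
    have h := (locallyIntegrable_inv_truncatedCoeff_mul (b₁ := b₁) (b₂ := b₂) (x₂ := x₂) k
      hp).smul (I * lam)
    exact h
  have hgraph : ∀ f : L2R, OperatorGraph a ((c • G) f) (lam ^ 2 • (c • G) f + f) := by
    intro f
    refine ⟨c • W f, (I * lam * c) • V f, ?_, ?_, ?_⟩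
    · intro φ hφ hφc
      have h := integral_splitKernel_mul_deriv hU hW hG hWk hs hulc hurc (hloc hvlc) (hloc hvrc)
        (fun x hx ↦ (((hsol x hx).2 lam _).1).congr_deriv (mul_assoc _ _ _))
        (fun x hx ↦ (((hsol x hx).2 lam _).1).congr_deriv (mul_assoc _ _ _))
        (j := 0) (fun y ↦ by ring) f hφ hφc
      have e1 : ∫ x, (c • G) f x * deriv φ x = c * ∫ x, G f x * deriv φ x := by
        rw [← integral_const_mul]
        refine integral_congr_ae ?_
        filter_upwards [Lp.coeFn_smul c (G f)] with x hx
        rw [_root_.smul_apply, hx, Pi.smul_apply, smul_eq_mul, mul_assoc]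
      have e2 : ∫ x, (c • W f : L2R) x * φ x = c * ∫ x, W f x * φ x := by
        rw [← integral_const_mul]
        refine integral_congr_ae ?_
        filter_upwards [Lp.coeFn_smul c (W f)] with x hx
        rw [hx, Pi.smul_apply, smul_eq_mul, mul_assoc]
      rw [e1, e2, h]
      ring
    · filter_upwards [Lp.coeFn_smul c (W f), Lp.coeFn_smul (I * lam * c) (V f), hVk f, hWk f]
        with x e1 e2 e3 e4
      have hax : (a x : ℂ) ≠ 0 := truncatedCoeff_ne_zero hb₁.ne' hb₂.ne' k x
      have e5 : ∫ y, splitKernel ul' ur' ul ur x y * f y =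
          I * lam * (a x : ℂ)⁻¹ * ∫ y, splitKernel vl vr ul ur x y * f y := by
        rw [← integral_const_mul]
        congr 1
        ext y
        simp only [splitKernel, hul', hur']
        split_ifs <;> ring
      rw [e1, e2, Pi.smul_apply, Pi.smul_apply, e3, e4, e5, smul_eq_mul, smul_eq_mul]
      field_simp
    · intro φ hφ hφc
      have h := integral_splitKernel_mul_deriv hV hV' hVk hV'k hs hvlc hvrc
        (continuous_const.mul hulc).locallyIntegrable (continuous_const.mul hurc).locallyIntegrable
        (fun x hx ↦ ((hsol x hx).2 lam _).2) (fun x hx ↦ ((hsol x hx).2 lam _).2)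
        (j := -D) (fun y ↦ by
          rw [hDdef, ← wronskian_jost (x₂ := x₂) hb₁.ne' hb₂.ne' k lam y, wronskian]
          ring) f hφ hφc
      have e1 : ∫ x, ((I * lam * c) • V f : L2R) x * deriv φ x
          = I * lam * c * ∫ x, V f x * deriv φ x := by
        rw [← integral_const_mul]
        refine integral_congr_ae ?_
        filter_upwards [Lp.coeFn_smul (I * lam * c) (V f)] with x hx
        rw [hx, Pi.smul_apply, smul_eq_mul, mul_assoc]
      have hint : ∀ v : L2R, Integrable fun x ↦ v x * φ x := fun v ↦ by
        simpa only [smul_eq_mul] using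
          (locallyIntegrable_L2R v).integrable_smul_right_of_hasCompactSupport hφ.continuous hφc
      have e2 : ∫ x, ((I * lam) • G) f x * φ x = I * lam * ∫ x, G f x * φ x := by
        rw [← integral_const_mul]
        refine integral_congr_ae ?_
        filter_upwards [Lp.coeFn_smul (I * lam) (G f)] with x hx
        rw [_root_.smul_apply, hx, Pi.smul_apply, smul_eq_mul, mul_assoc]
      have e3 : ∫ x, (-(lam ^ 2 • (c • G) f + f) : L2R) x * φ x =
          -(lam ^ 2 * c) * (∫ x, G f x * φ x) - ∫ x, f x * φ x := by
        rw [← integral_const_mul, ← integral_sub ((hint (G f)).const_mul _) (hint f)]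
        refine integral_congr_ae ?_
        filter_upwards [Lp.coeFn_neg (lam ^ 2 • (c • G) f + f),
          Lp.coeFn_add (lam ^ 2 • (c • G) f) f, Lp.coeFn_smul (lam ^ 2) ((c • G) f),
          Lp.coeFn_smul c (G f)] with x d1 d2 d3 d4
        rw [_root_.smul_apply] at d1 d2 d3 ⊢
        rw [d1, Pi.neg_apply, d2, Pi.add_apply, d3, Pi.smul_apply, d4, Pi.smul_apply, smul_eq_mul,
          smul_eq_mul]
        ring
      have hcD : I * lam * c * D = -1 := by
        rw [hc]
        field_simp
        exact Complex.I_sq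
      rw [e1, h, e2, e3]
      linear_combination (-(∫ x, f x * φ x)) * hcD -
        lam ^ 2 * c * (∫ x, G f x * φ x) * Complex.I_mul_I
  intro u v
  constructor
  · intro h
    have h1 := h.sub (hgraph v)
    have h2 : u - (c • G) v = 0 := by
      refine eq_zero_of_operatorGraph hb₁ hb₂ hx₀ hx₁ k hlam ?_
      rwa [show lam ^ 2 • u + v - (lam ^ 2 • (c • G) v + v) = lam ^ 2 • (u - (c • G) v) by
        rw [smul_sub]; abel] at h1
    exact sub_eq_zero.1 h2
  · rintro rfl
    exact hgraph v

end

/-! ### Meromorphic continuation and resonances -/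

open Classical in
/-- The restriction of a kernel to the square `[-N, N]²`. -/
def cutKernel (N : ℕ) (K : ℝ → ℝ → ℂ) (x y : ℝ) : ℂ :=
  if x ∈ Icc (-(N : ℝ)) N ∧ y ∈ Icc (-(N : ℝ)) N then K x y else 0

theorem measurable_cutKernel (N : ℕ) {K : ℝ → ℝ → ℂ} (hK : Measurable (Function.uncurry K)) :
    Measurable (Function.uncurry (cutKernel N K)) := by
  refine Measurable.ite ?_ hK measurable_const
  exact (measurableSet_Icc.preimage measurable_fst).inter
    (measurableSet_Icc.preimage measurable_snd)

theorem HasKernel.cutoff_comp {N : ℕ} {K : ℝ → ℝ → ℂ} {L : L2R →L[ℂ] L2R} (hL : HasKernel L K) :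
    HasKernel (cutoff N ∘L L ∘L cutoff N) (cutKernel N K) := by
  intro f
  filter_upwards [cutoffFun_ae N (L (cutoff N f)), hL (cutoff N f)] with x h1 h2
  change cutoffFun N (L (cutoff N f)) x = _
  rw [h1]
  by_cases hx : x ∈ Icc (-(N : ℝ)) N
  · rw [indicator_of_mem hx, h2]
    refine integral_congr_ae ?_
    filter_upwards [cutoffFun_ae N f] with y hy
    change K x y * cutoffFun N f y = _
    rw [hy, cutKernel]
    by_cases hy' : y ∈ Icc (-(N : ℝ)) N
    · rw [indicator_of_mem hy', if_pos ⟨hx, hy'⟩]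
    · rw [indicator_of_notMem hy', if_neg fun h ↦ hy' h.2, mul_zero, zero_mul]
  · rw [indicator_of_notMem hx]
    have : ∀ y, cutKernel N K x y = 0 := fun y ↦ if_neg fun h ↦ hx h.1
    simp [this]

theorem IsResolventAt.unique {a : ℝ → ℝ} {lam : ℂ} {R R' : L2R →L[ℂ] L2R}
    (h : IsResolventAt a lam R) (h' : IsResolventAt a lam R') : R = R' := by
  ext1 v
  exact (h' (R v) v).1 ((h (R v) v).2 rfl)

/-- Two continuations agree in the upper half plane, because the resolvent there is unique, so their
difference has infinite order at `i` and hence, `ℂ` being connected, everywhere. Poles thus do not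
depend on the chosen continuation. -/
theorem IsContinuedResolvent.meromorphicOrderAt_eq {a : ℝ → ℝ} {N : ℕ}
    {T T' : ℂ → L2R →L[ℂ] L2R} (h : IsContinuedResolvent a N T)
    (h' : IsContinuedResolvent a N T') (lam : ℂ) :
    meromorphicOrderAt T lam = meromorphicOrderAt T' lam := by
  have hm : Meromorphic (T - T') := fun z ↦ (h.1 z).sub (h'.1 z)
  have heq : ∀ z : ℂ, 0 < z.im → T z = T' z := by
    intro z hz
    obtain ⟨R, hR, hT⟩ := h.2 z hz
    obtain ⟨R', hR', hT'⟩ := h'.2 z hz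
    rw [hT, hT', hR.unique hR']
  have htop : meromorphicOrderAt (T - T') I = ⊤ := by
    rw [meromorphicOrderAt_eq_top_iff]
    refine eventually_nhdsWithin_of_eventually_nhds ?_
    filter_upwards [(isOpen_lt continuous_const Complex.continuous_im).mem_nhds
      (show (0 : ℝ) < I.im by simp)] with z hz
    rw [Pi.sub_apply, heq z hz, sub_self]
  have hlam : meromorphicOrderAt (T - T') lam = ⊤ := by
    by_contra hne
    exact (MeromorphicOn.meromorphicOrderAt_ne_top_of_isPreconnected (U := univ)
      (fun z _ ↦ hm z) isPreconnected_univ (mem_univ lam) (mem_univ I) hne) htop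
  rw [meromorphicOrderAt_eq_top_iff] at hlam
  exact meromorphicOrderAt_congr (hlam.mono fun z hz ↦ sub_eq_zero.1 hz)

section

variable {b₁ b₂ x₂ : ℝ}

/-- The Jost solutions are entire in `lam` and jointly continuous, hence bounded on compact sets of
`(lam, x)`, so the cut kernel is an entire, locally bounded family. -/
theorem exists_differentiable_cutKernel (hb₁ : 0 < b₁) (hx₀ : 0 < x₂)
    (hx₁ : x₂ < 1) (k N : ℕ) : ∃ S : ℂ → L2R →L[ℂ] L2R, Differentiable ℂ S ∧
      ∀ lam, HasKernel (S lam) (cutKernel N (greenKernel b₁ b₂ x₂ k lam)) := by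
  have hlc := continuous_jostLeft (b₂ := b₂) hb₁.ne' hx₀ hx₁ k
  have hrc := continuous_jostRight (b₂ := b₂) hb₁.ne' hx₀ hx₁ k
  have hm : ∀ lam, Measurable (Function.uncurry
      (cutKernel N (greenKernel b₁ b₂ x₂ k lam))) := by
    intro lam
    have h1 : Continuous fun x ↦ jostLeft b₁ b₂ x₂ k lam x :=
      hlc.comp (f := fun x : ℝ ↦ (lam, x)) (by fun_prop)
    have h2 : Continuous fun x ↦ jostRight b₁ b₂ x₂ k lam x :=
      hrc.comp (f := fun x : ℝ ↦ (lam, x)) (by fun_prop)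
    exact measurable_cutKernel N (measurable_splitKernel h1.fst.measurable h2.fst.measurable
      h1.fst.measurable h2.fst.measurable)
  have hC : ∀ r : ℝ, ∃ C : ℝ≥0, ∀ lam ∈ Metric.closedBall (0 : ℂ) r, ∀ x y,
      ‖cutKernel N (greenKernel b₁ b₂ x₂ k lam) x y‖ ≤ C := by
    intro r
    have hcomp : IsCompact (Metric.closedBall (0 : ℂ) r ×ˢ Icc (-(N : ℝ)) N) :=
      (isCompact_closedBall 0 r).prod isCompact_Icc
    obtain ⟨Cl, hCl⟩ := hcomp.exists_bound_of_continuousOn hlc.continuousOn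
    obtain ⟨Cr, hCr⟩ := hcomp.exists_bound_of_continuousOn hrc.continuousOn
    refine ⟨(|Cl| * |Cr|).toNNReal, fun lam hlam x y ↦ ?_⟩
    rw [Real.coe_toNNReal _ (by positivity), cutKernel]
    split_ifs with h
    · have l (z : ℝ) (hz : z ∈ Icc (-(N : ℝ)) N) : ‖(jostLeft b₁ b₂ x₂ k lam z).1‖ ≤ |Cl| :=
        (norm_fst_le _).trans ((hCl (lam, z) ⟨hlam, hz⟩).trans (le_abs_self _))
      have r (z : ℝ) (hz : z ∈ Icc (-(N : ℝ)) N) : ‖(jostRight b₁ b₂ x₂ k lam z).1‖ ≤ |Cr| :=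
        (norm_fst_le _).trans ((hCr (lam, z) ⟨hlam, hz⟩).trans (le_abs_self _))
      rw [greenKernel, splitKernel]
      split_ifs
      · rw [norm_mul]
        exact mul_le_mul (l x h.1) (r y h.2) (norm_nonneg _) (abs_nonneg _)
      · rw [norm_mul, mul_comm]
        exact mul_le_mul (l y h.2) (r x h.1) (norm_nonneg _) (abs_nonneg _)
    · rw [norm_zero]
      positivity
  have h0 : ∀ lam x y, ¬ (x ∈ Icc (-(N : ℝ)) N ∧ y ∈ Icc (-(N : ℝ)) N) →
      cutKernel N (greenKernel b₁ b₂ x₂ k lam) x y = 0 := fun lam x y h ↦ if_neg h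
  have hS : ∀ lam, ∃ S : L2R →L[ℂ] L2R,
      HasKernel S (cutKernel N (greenKernel b₁ b₂ x₂ k lam)) := by
    intro lam
    obtain ⟨C, hC⟩ := hC ‖lam‖
    exact (IsSchurKernel.ofBoundedOn (hm lam) (hC lam (by simp)) (h0 lam)).exists_hasKernel
  choose S hS using hS
  refine ⟨S, differentiable_of_hasKernel hS hm h0 (fun x y ↦ ?_) hC, hS⟩
  have hl := fun x ↦ (differentiable_jostLeft (b₁ := b₁) (b₂ := b₂) (x₂ := x₂) k x).fst
  have hr := fun x ↦ (differentiable_jostRight (b₁ := b₁) (b₂ := b₂) (x₂ := x₂) k x).fst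
  simp only [cutKernel, greenKernel, splitKernel]
  split_ifs
  · exact (hl x).mul (hr y)
  · exact (hr x).mul (hl y)
  · exact differentiable_const _

theorem isContinuedResolvent_smul (hb₁ : 0 < b₁) (hb₂ : 0 < b₂) (hx₀ : 0 < x₂)
    (hx₁ : x₂ < 1) (k N : ℕ) {S : ℂ → L2R →L[ℂ] L2R} (hSd : Differentiable ℂ S)
    (hS : ∀ lam, HasKernel (S lam) (cutKernel N (greenKernel b₁ b₂ x₂ k lam))) :
    IsContinuedResolvent (truncatedCoeff b₁ b₂ x₂ k) N
      ((fun lam ↦ I / (lam * jostDet b₁ b₂ x₂ k lam)) • S) := by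
  have hD := differentiable_jostDet (b₁ := b₁) (b₂ := b₂) (x₂ := x₂) k
  refine ⟨fun lam ↦ ?_, fun lam hlam ↦ ?_⟩
  · refine MeromorphicAt.smul ?_ (hSd.analyticAt lam).meromorphicAt
    exact (MeromorphicAt.const I lam).div
      ((differentiable_id.mul hD).analyticAt lam).meromorphicAt
  · obtain ⟨R, G, A, hR, hRG, -, hG⟩ := exists_isResolventAt hb₁ hb₂ hx₀ hx₁ k hlam
    refine ⟨R, hR, ?_⟩
    rw [Pi.smul_apply', (hS lam).unique hG.cutoff_comp, hRG]
    simp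

/-- For `x` beyond the structure and `y` in front of it the kernel is a product of explicit
exponentials. Tested on the wave inverse to the left Jost solution on `[-1, 0]`, it gives `b₁²`
times an exponential for `x ∈ (k, k + 1]`. The cutoff `k + 1` makes room for both intervals. -/
theorem exists_cutKernel_ne_zero (hb₁ : 0 < b₁) (hb₂ : 0 < b₂) (hx₀ : 0 < x₂)
    (hx₁ : x₂ < 1) (k : ℕ) (lam : ℂ) {S : L2R →L[ℂ] L2R}
    (hS : HasKernel S (cutKernel (k + 1) (greenKernel b₁ b₂ x₂ k lam))) : S ≠ 0 := by
  rintro rfl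
  have hb₁' : (b₁ : ℂ) ≠ 0 := by exact_mod_cast hb₁.ne'
  have hk : (0 : ℝ) ≤ k := k.cast_nonneg
  set e : ℝ → ℂ := fun y ↦ Complex.exp (lam * b₁ * y * I) with he
  have hec : Continuous e := by fun_prop
  have hmem : MemLp ((Icc (-1 : ℝ) 0).indicator e) 2 volume := by
    rw [memLp_indicator_iff_restrict measurableSet_Icc]
    obtain ⟨C, hC⟩ := (isCompact_Icc (a := (-1 : ℝ)) (b := 0)).exists_bound_of_continuousOn
      hec.continuousOn
    exact MemLp.of_bound hec.aestronglyMeasurable C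
      ((ae_restrict_mem measurableSet_Icc).mono hC)
  set v : L2R := hmem.toLp with hv
  have hne : ∀ x ∈ Ioc (k : ℝ) (k + 1), ∫ y, cutKernel (k + 1) (greenKernel b₁ b₂ x₂ k lam) x y *
      v y ≠ 0 := by
    intro x hx
    have h1 : ∫ y, cutKernel (k + 1) (greenKernel b₁ b₂ x₂ k lam) x y * v y =
        ∫ y, (Icc (-1 : ℝ) 0).indicator (fun _ ↦ (jostRight b₁ b₂ x₂ k lam x).1 * b₁) y := by
      refine integral_congr_ae ?_
      filter_upwards [hmem.coeFn_toLp] with y hy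
      rw [hy]
      by_cases hy' : y ∈ Icc (-1 : ℝ) 0
      · rw [indicator_of_mem hy', indicator_of_mem hy', cutKernel, if_pos, greenKernel,
          splitKernel, if_neg (by linarith [hx.1, hy'.2]), jostLeft_of_nonpos hb₁.ne' hx₀ k lam
          hy'.2]
        · simp only [Prod.smul_fst, smul_eq_mul, he]
          have : Complex.exp (-(lam * b₁ * y) * I) * Complex.exp (lam * b₁ * y * I) = 1 := by
            rw [← Complex.exp_add, ← Complex.exp_zero]
            ring_nf
          linear_combination (jostRight b₁ b₂ x₂ k lam x).1 * b₁ * this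
        · push_cast
          exact ⟨⟨by linarith [hx.1], hx.2⟩, by linarith [hy'.1], by linarith [hy'.2]⟩
      · rw [indicator_of_notMem hy', indicator_of_notMem hy', mul_zero]
    rw [h1, integral_indicator measurableSet_Icc, setIntegral_const,
      jostRight_of_ge hb₁.ne' hb₂.ne' hx₁ k lam hx.1.le]
    simp [hb₁']
  have h := hS v
  have hnull : volume (Ioc (k : ℝ) (k + 1)) = 0 := by
    refine measure_mono_null (fun x hx ↦ ?_) (ae_iff.1 (h.and (Lp.coeFn_zero ℂ 2 volume)))
    rintro ⟨h1, h2⟩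
    exact hne x hx (h1.symm.trans h2)
  simp at hnull

/-- The resonances are the zeros of the Wronskian of the Jost solutions. -/
theorem mem_Res_iff (hb₁ : 0 < b₁) (hb₂ : 0 < b₂) (hx₀ : 0 < x₂) (hx₁ : x₂ < 1) (k : ℕ)
    (lam : ℂ) : lam ∈ Res (truncatedCoeff b₁ b₂ x₂ k) ↔
      lam.im < 0 ∧ jostDet b₁ b₂ x₂ k lam = 0 := by
  have hD := differentiable_jostDet (b₁ := b₁) (b₂ := b₂) (x₂ := x₂) k
  have hW : Differentiable ℂ fun z ↦ z * jostDet b₁ b₂ x₂ k z := differentiable_id.mul hD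
  constructor
  · rintro ⟨him, N, T, hT, hord⟩
    refine ⟨him, ?_⟩
    by_contra hne
    obtain ⟨S, hSd, hS⟩ := exists_differentiable_cutKernel (b₂ := b₂) hb₁ hx₀ hx₁ k N
    rw [hT.meromorphicOrderAt_eq (isContinuedResolvent_smul hb₁ hb₂ hx₀ hx₁ k N hSd hS)] at hord
    have hlam0 : lam ≠ 0 := by
      rintro rfl
      simp at him
    refine absurd hord (not_lt.2 (AnalyticAt.meromorphicOrderAt_nonneg ?_))
    exact (analyticAt_const.div (hW.analyticAt lam) (mul_ne_zero hlam0 hne)).smul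
      (hSd.analyticAt lam)
  · rintro ⟨him, h0⟩
    obtain ⟨S, hSd, hS⟩ := exists_differentiable_cutKernel (b₂ := b₂) hb₁ hx₀ hx₁ k (k + 1)
    have hT := isContinuedResolvent_smul hb₁ hb₂ hx₀ hx₁ k (k + 1) hSd hS
    refine ⟨him, k + 1, _, hT, ?_⟩
    -- The scalar factor blows up while `S z` tends to the nonzero operator `S lam`, so the product
    -- is unbounded and `lam` is a pole.
    rw [← tendsto_cobounded_iff_meromorphicOrderAt_neg (hT.1 lam)]
    -- The zero is isolated, since the entire function `z D(z)` does not vanish at `i`.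
    have hne : ∀ᶠ z in 𝓝[≠] lam, z * jostDet b₁ b₂ x₂ k z ≠ 0 := by
      rcases (hW.analyticAt lam).eventually_eq_zero_or_eventually_ne_zero with h | h
      · exfalso
        have hA : AnalyticOnNhd ℂ (fun z ↦ z * jostDet b₁ b₂ x₂ k z) univ :=
          fun z _ ↦ hW.analyticAt z
        have h1 := hA.eqOn_zero_of_preconnected_of_eventuallyEq_zero isPreconnected_univ (mem_univ lam) h
        have h2 := h1 (mem_univ I)
        exact mul_ne_zero Complex.I_ne_zero
          (jostDet_ne_zero hb₁ hb₂ hx₀ hx₁ (by simp : (0 : ℝ) ≤ I.im) k) h2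
      · exact h
    have hinv : Tendsto (fun z ↦ ‖I / (z * jostDet b₁ b₂ x₂ k z)‖) (𝓝[≠] lam) atTop := by
      have ht : Tendsto (fun z ↦ z * jostDet b₁ b₂ x₂ k z) (𝓝[≠] lam) (𝓝[≠] 0) := by
        refine tendsto_nhdsWithin_iff.2 ⟨?_, hne⟩
        have := hW.continuous.tendsto lam
        rw [h0, mul_zero] at this
        exact this.mono_left nhdsWithin_le_nhds
      have h2 := (tendsto_norm_inv_nhdsNE_zero_atTop (α := ℂ)).comp ht
      refine h2.congr fun z ↦ ?_
      simp
    have hSn : Tendsto (fun z ↦ ‖S z‖) (𝓝[≠] lam) (𝓝 ‖S lam‖) :=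
      (hSd.continuous.norm.tendsto lam).mono_left nhdsWithin_le_nhds
    rw [← tendsto_norm_atTop_iff_cobounded]
    refine (hinv.atTop_mul_pos (norm_pos_iff.2
      (exists_cutKernel_ne_zero hb₁ hb₂ hx₀ hx₁ k lam (hS lam))) hSn).congr fun z ↦ ?_
    rw [Pi.smul_apply', norm_smul]

end

/-! ### Degenerate band edges and periodicity -/

section

variable {b₁ b₂ x₂ : ℝ}

theorem rho_pos (hb₁ : 0 < b₁) (hb₂ : 0 < b₂) : 0 < rho b₁ b₂ := by
  unfold rho
  positivity

/-- Equal optical thickness makes the second cosine identically `1`. The upper value `F = 1` is then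
attained only at the zeros of the sine and is touched without being crossed, so the gaps there are
closed. -/
theorem lyapunov_of_balanced (h : b₂ * x₂ = b₁ * (1 - x₂)) (lam : ℝ) :
    lyapunov b₁ b₂ x₂ lam = 1 - (rho b₁ b₂ + 1) * Real.sin (lam * (x₂ * b₂)) ^ 2 := by
  have h1 : lam * (x₂ * b₂ + (1 - x₂) * b₁) = 2 * (lam * (x₂ * b₂)) := by
    linear_combination (-lam) * h
  have h2 : lam * (x₂ * b₂ - (1 - x₂) * b₁) = 0 := by
    linear_combination lam * h
  rw [lyapunov, h1, h2, Real.cos_two_mul, Real.cos_zero]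
  linear_combination (rho b₁ b₂ + 1) * Real.sin_sq_add_cos_sq (lam * (x₂ * b₂))

theorem lyapunov_add_of_balanced (hb₂ : 0 < b₂) (hx₀ : 0 < x₂) (h : b₂ * x₂ = b₁ * (1 - x₂))
    (m : ℤ) (t : ℝ) : lyapunov b₁ b₂ x₂ (Real.pi * m / (x₂ * b₂) + t)
      = 1 - (rho b₁ b₂ + 1) * Real.sin (t * (x₂ * b₂)) ^ 2 := by
  have h1 : (Real.pi * m / (x₂ * b₂) + t) * (x₂ * b₂) = t * (x₂ * b₂) + m * Real.pi := by
    field_simp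
    ring
  rw [lyapunov_of_balanced h, h1, Real.sin_add_int_mul_pi]
  rcases Int.even_or_odd m with hm | hm
  · simp [hm.neg_one_zpow]
  · simp [hm.neg_one_zpow]

theorem isDegenerateBandEdge_of_balanced (hb₁ : 0 < b₁) (hb₂ : 0 < b₂) (hx₀ : 0 < x₂)
    (h : b₂ * x₂ = b₁ * (1 - x₂)) (m : ℤ) :
    IsDegenerateBandEdge b₁ b₂ x₂ (Real.pi * m / (x₂ * b₂)) := by
  have hρ := rho_pos hb₁ hb₂
  set c := x₂ * b₂ with hc
  have hc0 : 0 < c := by positivity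
  set e := Real.pi * m / c with he
  -- With phase at most `d` one has `(ρ + 1) sin² ≤ (ρ + 1) d² = d < 2`, which keeps `F` above `-1`;
  -- `d < 1 < π` keeps the sine positive.
  set d := 1 / (rho b₁ b₂ + 1) with hd
  have hd0 : 0 < d := by positivity
  have hd1 : d < 1 := by
    rw [hd, div_lt_one (by positivity)]
    linarith
  set δ := d / c with hδ
  have hδ0 : 0 < δ := by positivity
  have hF : ∀ t, lyapunov b₁ b₂ x₂ (e + t) = 1 - (rho b₁ b₂ + 1) * Real.sin (t * c) ^ 2 :=
    lyapunov_add_of_balanced hb₂ hx₀ h m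
  have hpos : ∀ t, 0 < t → t ≤ δ → 0 < (rho b₁ b₂ + 1) * Real.sin (t * c) ^ 2 ∧
      (rho b₁ b₂ + 1) * Real.sin (t * c) ^ 2 < 2 := by
    intro t ht0 ht
    have htc : t * c ≤ d := by rwa [hδ, le_div_iff₀ hc0] at ht
    have htc0 : 0 < t * c := by positivity
    have hs0 : 0 < Real.sin (t * c) :=
      Real.sin_pos_of_pos_of_lt_pi htc0 (by linarith [Real.pi_gt_three])
    have hs1 : Real.sin (t * c) ≤ d := (Real.sin_le htc0.le).trans htc
    refine ⟨by positivity, ?_⟩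
    calc (rho b₁ b₂ + 1) * Real.sin (t * c) ^ 2 ≤ (rho b₁ b₂ + 1) * d ^ 2 := by gcongr
      _ = d := by
        rw [hd]
        field_simp
      _ < 2 := by linarith
  have hband : ∀ t, 0 < |t| → |t| ≤ δ → e + t ∈ bandSpectrum b₁ b₂ x₂ := by
    intro t ht0 ht
    have h1 : Real.sin (t * c) ^ 2 = Real.sin (|t| * c) ^ 2 := by
      rcases abs_choice t with h | h <;> rw [h]
      rw [neg_mul, Real.sin_neg, neg_sq]
    obtain ⟨h2, h3⟩ := hpos |t| ht0 ht
    rw [bandSpectrum, mem_ofPred_eq, hF, h1, sq_abs, sq_lt_one_iff_abs_lt_one, abs_lt]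
    constructor <;> linarith
  have he1 : lyapunov b₁ b₂ x₂ e = 1 := by simpa using hF 0
  have heb : e ∉ bandSpectrum b₁ b₂ x₂ := by
    rw [bandSpectrum, mem_ofPred_eq, he1]
    norm_num
  have hR : e + δ ∈ bandSpectrum b₁ b₂ x₂ :=
    hband δ (by rwa [abs_of_pos hδ0]) (by rw [abs_of_pos hδ0])
  have hL : e + -δ ∈ bandSpectrum b₁ b₂ x₂ :=
    hband (-δ) (by rwa [abs_neg, abs_of_pos hδ0]) (by rw [abs_neg, abs_of_pos hδ0])
  have hRsub : Ioc e (e + δ) ⊆ connectedComponentIn (bandSpectrum b₁ b₂ x₂) (e + δ) := by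
    refine isPreconnected_Ioc.subset_connectedComponentIn ⟨by linarith, le_rfl⟩ fun x hx ↦ ?_
    have h0 : 0 < x - e := by linarith [hx.1]
    have := hband (x - e) (by rwa [abs_of_pos h0]) (by rw [abs_of_pos h0]; linarith [hx.2])
    rwa [add_sub_cancel] at this
  have hLsub : Ico (e + -δ) e ⊆ connectedComponentIn (bandSpectrum b₁ b₂ x₂) (e + -δ) := by
    refine isPreconnected_Ico.subset_connectedComponentIn ⟨le_rfl, by linarith⟩ fun x hx ↦ ?_
    have h0 : x - e < 0 := by linarith [hx.2]
    have := hband (x - e) (by rw [abs_of_neg h0]; linarith)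
      (by rw [abs_of_neg h0]; linarith [hx.1])
    rwa [add_sub_cancel] at this
  have hnot : ∀ x, e ∉ interior (connectedComponentIn (bandSpectrum b₁ b₂ x₂) x) := fun x hx ↦
    heb (connectedComponentIn_subset _ _ (interior_subset hx))
  refine ⟨Or.inl he1, _, _, ⟨_, hR, rfl⟩, ⟨_, hL, rfl⟩, fun heq ↦ ?_, ⟨?_, hnot _⟩, ⟨?_, hnot _⟩⟩
  -- If the two components coincided, their interval would contain `e`, which is not in the
  -- spectrum.
  · have hm1 : e + δ ∈ connectedComponentIn (bandSpectrum b₁ b₂ x₂) (e + δ) :=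
      mem_connectedComponentIn hR
    have hm2 : e + -δ ∈ connectedComponentIn (bandSpectrum b₁ b₂ x₂) (e + δ) := by
      rw [heq]
      exact mem_connectedComponentIn hL
    have hm3 := isPreconnected_connectedComponentIn.ordConnected.out hm2 hm1
      (⟨by linarith, by linarith⟩ : e ∈ Icc (e + -δ) (e + δ))
    exact heb (connectedComponentIn_subset _ _ hm3)
  · refine closure_mono hRsub ?_
    rw [closure_Ioc (by linarith)]
    exact ⟨le_rfl, by linarith⟩
  · refine closure_mono hLsub ?_
    rw [closure_Ico (by linarith)]
    exact ⟨by linarith, le_rfl⟩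

theorem layer_add_pi (b : ℝ) (θ : ℂ) (w : ℂ × ℂ) : layer b (θ + Real.pi) w = -layer b θ w := by
  ext
  · simp [layer, Complex.cos_add_pi, Complex.sin_add_pi]
    ring
  · simp [layer, Complex.cos_add_pi, Complex.sin_add_pi]
    ring

theorem layer_neg (b : ℝ) (θ : ℂ) (w : ℂ × ℂ) : layer b θ (-w) = -layer b θ w := by
  ext
  · simp [layer]
    ring
  · simp [layer]
    ring

/-- Each of the two phases grows by `π` and each layer map changes sign. The signs cancel in the
product, so the period corresponds to a phase of `π` rather than `2π`. -/
theorem cell_add_period (hb₂ : 0 < b₂) (hx₀ : 0 < x₂) (h : b₂ * x₂ = b₁ * (1 - x₂)) (lam : ℂ) :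
    cell b₁ b₂ x₂ (lam + ((Real.pi / (b₂ * x₂) : ℝ) : ℂ)) = cell b₁ b₂ x₂ lam := by
  have h' : (b₂ : ℂ) * x₂ = b₁ * (1 - x₂) := by exact_mod_cast h
  have hb : (b₂ : ℂ) ≠ 0 := by exact_mod_cast hb₂.ne'
  have hx : (x₂ : ℂ) ≠ 0 := by exact_mod_cast hx₀.ne'
  have e0 : ((Real.pi / (b₂ * x₂) : ℝ) : ℂ) * (b₂ * x₂) = Real.pi := by
    push_cast
    field_simp
  ext1 w
  have e1 : (lam + ((Real.pi / (b₂ * x₂) : ℝ) : ℂ)) * b₂ * x₂ = lam * b₂ * x₂ + Real.pi := by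
    linear_combination e0
  have e2 : (lam + ((Real.pi / (b₂ * x₂) : ℝ) : ℂ)) * b₁ * (1 - x₂)
      = lam * b₁ * (1 - x₂) + Real.pi := by
    linear_combination e0 - ((Real.pi / (b₂ * x₂) : ℝ) : ℂ) * h'
  rw [cell, cell, e1, e2, layer_add_pi, layer_add_pi, layer_neg, neg_neg]

end

/-! ### Resonances approach the real axis -/

/-- The closed form of the powers of a unimodular two by two matrix, evaluated at a zero of a
diagonal entry. -/
theorem mul_norm_pow_le_of_recurrence_eq_zero {A B C E μ : ℂ} (hdet : A * E - B * C = 1)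
    {p m : ℕ → ℂ} (hp : ∀ n, p (n + 1) = A * p n + B * m n)
    (hm : ∀ n, m (n + 1) = C * p n + E * m n) (hp0 : p 0 = 0) (hm0 : m 0 ≠ 0)
    (hμ : μ ^ 2 - (A + E) * μ + 1 = 0) (hμ1 : 1 ≤ ‖μ‖) {κ : ℝ} (hκ : 0 ≤ κ)
    (hκ2 : κ ^ 2 = ‖B * C‖) {k : ℕ} (hk : m k = 0) : κ * ‖μ‖ ^ k ≤ κ + 2 * ‖μ‖ := by
  have hμ0 : μ ≠ 0 := norm_pos_iff.1 (by linarith)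
  have hr : ‖μ‖ ≠ 0 := by positivity
  have hrec : ∀ n, m (n + 2) = (A + E) * m (n + 1) - m n := by
    intro n
    rw [hm (n + 1), hp n]
    linear_combination (-A) * hm n - (m n) * hdet
  have hsum : A + E = μ + μ⁻¹ := by
    field_simp
    linear_combination (-1 : ℂ) * hμ
  -- By Cayley–Hamilton `m` obeys the two-term recurrence with roots `μ` and `μ⁻¹`. Keeping the
  -- factor `μ - μ⁻¹` on the left avoids a separate case for a double root.
  have hform : ∀ n, (μ - μ⁻¹) * m n = m 0 * (μ ^ n * (E - μ⁻¹) - μ⁻¹ ^ n * (E - μ)) ∧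
      (μ - μ⁻¹) * m (n + 1) =
        m 0 * (μ ^ (n + 1) * (E - μ⁻¹) - μ⁻¹ ^ (n + 1) * (E - μ)) := by
    intro n
    induction n with
    | zero =>
      refine ⟨by ring, ?_⟩
      rw [hm 0, hp0]
      have : μ * μ⁻¹ = 1 := mul_inv_cancel₀ hμ0
      ring
    | succ n ih =>
      refine ⟨ih.2, ?_⟩
      have h1 : μ * μ⁻¹ = 1 := mul_inv_cancel₀ hμ0
      rw [hrec n, hsum]
      linear_combination (μ + μ⁻¹) * ih.2 - ih.1 + m 0 * (μ ^ n * (E - μ⁻¹)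
        - μ⁻¹ ^ n * (E - μ)) * h1
  have h0 : μ ^ k * (E - μ⁻¹) = μ⁻¹ ^ k * (E - μ) := by
    have h1 := (hform k).1
    rw [hk, mul_zero] at h1
    exact sub_eq_zero.1 ((mul_eq_zero.1 h1.symm).resolve_left hm0)
  have hprod : (E - μ) * (E - μ⁻¹) = -(B * C) := by
    have h1 : μ * μ⁻¹ = 1 := mul_inv_cancel₀ hμ0
    linear_combination h1 - hdet + E * hsum
  set X := ‖E - μ⁻¹‖ with hX
  set Y := ‖E - μ‖ with hY
  have hn1 : ‖μ‖ ^ k * X = (‖μ‖ ^ k)⁻¹ * Y := by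
    have := congrArg norm h0
    simpa [norm_mul, norm_pow, norm_inv] using this
  have hn2 : Y * X = κ ^ 2 := by
    rw [hκ2, hX, hY, ← norm_mul, hprod, norm_neg]
  set R := ‖μ‖ ^ k with hR
  have hR1 : 1 ≤ R := one_le_pow₀ hμ1
  have hYR : Y = R ^ 2 * X := by
    have : R ≠ 0 := by positivity
    field_simp at hn1
    linear_combination -hn1
  -- The equation `m k = 0` fixes the ratio `Y = R² X`, and the determinant fixes the product `Y X =
  -- κ²`. So `Y = κ R`, while the triangle inequality bounds `Y` by `κ + 2 ‖μ‖`.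
  have hXR : R * X = κ := by
    have h1 : (R * X) ^ 2 = κ ^ 2 := by rw [← hn2, hYR]; ring
    have h2 : 0 ≤ R * X := by positivity
    exact (sq_eq_sq₀ h2 hκ).1 h1
  have hXκ : X ≤ κ := by
    rw [← hXR]
    exact le_mul_of_one_le_left (norm_nonneg _) hR1
  have htri : Y ≤ X + (‖μ‖⁻¹ + ‖μ‖) := by
    calc Y = ‖(E - μ⁻¹) + (μ⁻¹ - μ)‖ := by rw [hY]; congr 1; ring
      _ ≤ X + ‖μ⁻¹ - μ‖ := norm_add_le _ _
      _ ≤ X + (‖μ‖⁻¹ + ‖μ‖) := by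
        gcongr
        exact (norm_sub_le _ _).trans (by rw [norm_inv])
  have hinv : ‖μ‖⁻¹ ≤ ‖μ‖ := (inv_le_one_of_one_le₀ hμ1).trans hμ1
  calc κ * R = Y := by rw [hYR, ← hXR]; ring
    _ ≤ κ + 2 * ‖μ‖ := by linarith

/-- The two roots have product `1`, so they cannot both lie inside the unit disc. -/
theorem exists_root_one_le_norm (τ : ℂ) : ∃ μ : ℂ, μ ^ 2 - τ * μ + 1 = 0 ∧ 1 ≤ ‖μ‖ := by
  obtain ⟨s, hs⟩ := IsAlgClosed.exists_pow_nat_eq (τ ^ 2 - 4) two_pos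
  have h1 : ((τ + s) / 2) ^ 2 - τ * ((τ + s) / 2) + 1 = 0 := by linear_combination hs / 4
  have h2 : ((τ - s) / 2) ^ 2 - τ * ((τ - s) / 2) + 1 = 0 := by linear_combination hs / 4
  have h3 : ‖(τ + s) / 2‖ * ‖(τ - s) / 2‖ = 1 := by
    rw [← norm_mul, show (τ + s) / 2 * ((τ - s) / 2) = 1 by linear_combination -hs / 4, norm_one]
  by_cases h : 1 ≤ ‖(τ + s) / 2‖
  · exact ⟨_, h1, h⟩
  · refine ⟨_, h2, ?_⟩
    by_contra h'
    have := mul_lt_one_of_nonneg_of_lt_one_left (norm_nonneg _) (not_le.1 h) (not_le.1 h').le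
    linarith

/-- The chain is `‖sin θ‖ ≥ sinh |Im θ| ≥ |Im θ|`. It bounds the reflection of a cell from below
without reference to `Re θ`. -/
theorem abs_im_le_norm_sin (θ : ℂ) : |θ.im| ≤ ‖Complex.sin θ‖ := by
  have key : ∀ θ : ℂ, 0 ≤ θ.im → θ.im ≤ ‖Complex.sin θ‖ := by
    intro θ hθ
    have h1 : Real.sinh θ.im ≤ ‖Complex.sin θ‖ := by
      rw [Complex.sin, norm_div, Complex.norm_two, norm_mul, Complex.norm_I, mul_one,
        Real.sinh_eq]
      gcongr
      refine le_trans (le_of_eq ?_) (norm_sub_norm_le _ _)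
      rw [Complex.norm_exp, Complex.norm_exp]
      simp
    exact (Real.self_le_sinh_iff.2 hθ).trans h1
  rcases le_total 0 θ.im with h | h
  · rw [abs_of_nonneg h]
    exact key θ h
  · rw [abs_of_nonpos h]
    have := key (-θ) (by simpa using h)
    simpa using this

section

variable {b₁ b₂ x₂ : ℝ}

/-- The right-going part is multiplied by exactly this factor, and the left-going part, which counts
negatively, by a smaller one. The flux itself may have either sign. -/
theorem exp_mul_flux_le_flux_layer {b : ℝ} (hb : 0 < b) {θ : ℂ} (hθ : θ.im ≤ 0) (w : ℂ × ℂ) :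
    Real.exp (-2 * θ.im) * flux w ≤ flux (layer b θ w) := by
  have h1 := four_mul_flux_layer hb.ne' θ w
  have h2 := four_mul_flux b w
  have e1 : Real.exp (2 * θ.im) ≤ Real.exp (-2 * θ.im) := Real.exp_le_exp.2 (by linarith)
  have n2 := sq_nonneg ‖w.1 - b * w.2‖
  have : 4 * b * (Real.exp (-2 * θ.im) * flux w) ≤ 4 * b * flux (layer b θ w) := by
    rw [h1, mul_left_comm, h2]
    nlinarith
  exact le_of_mul_le_mul_left this (by positivity)

theorem flux_le_flux_layer {b : ℝ} (hb : 0 < b) {θ : ℂ} (hθ : θ.im ≤ 0) (w : ℂ × ℂ) :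
    flux w ≤ flux (layer b θ w) := by
  have h1 := four_mul_flux_layer hb.ne' θ w
  have h2 := four_mul_flux b w
  have e1 : Real.exp (2 * θ.im) ≤ 1 := Real.exp_le_one_iff.2 (by linarith)
  have e2 : 1 ≤ Real.exp (-2 * θ.im) := Real.one_le_exp (by linarith)
  have n1 := sq_nonneg ‖w.1 + b * w.2‖
  have n2 := sq_nonneg ‖w.1 - b * w.2‖
  have : 4 * b * flux w ≤ 4 * b * flux (layer b θ w) := by
    rw [h1, h2]
    nlinarith
  exact le_of_mul_le_mul_left this (by positivity)

theorem flux_lt_flux_layer {b : ℝ} (hb : 0 < b) {θ : ℂ} (hθ : θ.im < 0) {w : ℂ × ℂ}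
    (hw : w ≠ 0) : flux w < flux (layer b θ w) := by
  have h1 := four_mul_flux_layer hb.ne' θ w
  have h2 := four_mul_flux b w
  have e1 : Real.exp (2 * θ.im) < 1 := by simpa using Real.exp_lt_exp.2 (show 2 * θ.im < 0 by linarith)
  have e2 : 1 < Real.exp (-2 * θ.im) := Real.one_lt_exp_iff.2 (by linarith)
  have n1 := sq_nonneg ‖w.1 + b * w.2‖
  have n2 := sq_nonneg ‖w.1 - b * w.2‖
  have hne : 0 < ‖w.1 + b * w.2‖ ^ 2 + ‖w.1 - b * w.2‖ ^ 2 := by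
    refine lt_of_le_of_ne (by positivity) fun h0 ↦ hw ?_
    have z1 : w.1 + b * w.2 = 0 := norm_eq_zero.1 (pow_eq_zero_iff two_ne_zero |>.1 (by linarith))
    have z2 : w.1 - b * w.2 = 0 := norm_eq_zero.1 (pow_eq_zero_iff two_ne_zero |>.1 (by linarith))
    have hb' : (b : ℂ) ≠ 0 := by exact_mod_cast hb.ne'
    ext
    · simp only [Prod.fst_zero]
      linear_combination (z1 + z2) / 2
    · have : (b : ℂ) * w.2 = 0 := by linear_combination (z1 - z2) / 2
      simpa using (mul_eq_zero.1 this).resolve_left hb'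
  have : 4 * b * flux w < 4 * b * flux (layer b θ w) := by
    rw [h1, h2]
    rcases n1.lt_or_eq with h | h
    · nlinarith
    · rw [← h] at hne ⊢
      nlinarith
  exact lt_of_mul_lt_mul_left this (by positivity)

/-- A Floquet multiplier outside the unit disc is bounded away from the unit circle. -/
theorem exp_le_norm_of_cell_eq_smul (hb₁ : 0 < b₁) (hb₂ : 0 < b₂) (hx₀ : 0 < x₂) (hx₁ : x₂ < 1)
    {lam : ℂ} (hlam : lam.im < 0) {μ : ℂ} (hμ : 1 ≤ ‖μ‖) {w : ℂ × ℂ} (hw : w ≠ 0)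
    (h : cell b₁ b₂ x₂ lam w = μ • w) : Real.exp (-lam.im * b₂ * x₂) ≤ ‖μ‖ := by
  have hθ₁ : (lam * b₁ * (1 - x₂)).im = lam.im * b₁ * (1 - x₂) := by simp [Complex.mul_im]
  have hθ₂ : (lam * b₂ * x₂).im = lam.im * b₂ * x₂ := by simp [Complex.mul_im]
  have hn₁ : (lam * b₁ * (1 - x₂)).im ≤ 0 := by
    rw [hθ₁]
    exact mul_nonpos_of_nonpos_of_nonneg (mul_nonpos_of_nonpos_of_nonneg hlam.le hb₁.le)
      (by linarith)
  have hn₂ : (lam * b₂ * x₂).im < 0 := by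
    rw [hθ₂]
    exact mul_neg_of_neg_of_pos (mul_neg_of_neg_of_pos hlam hb₂) hx₀
  have h1 := flux_le_flux_layer hb₁ hn₁ (layer b₂ (lam * b₂ * x₂) w)
  have h2 := flux_lt_flux_layer hb₂ hn₂ hw
  have h3 := exp_mul_flux_le_flux_layer hb₂ hn₂.le w
  have h4 : flux (μ • w) = ‖μ‖ ^ 2 * flux w := by
    rw [flux, flux, ← Complex.normSq_eq_norm_sq, ← Complex.re_ofReal_mul, ← Complex.mul_conj]
    congr 1
    simp only [Prod.smul_fst, Prod.smul_snd, smul_eq_mul, map_mul]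
    ring
  rw [← cell, h, h4] at h1
  have hμ2 : 1 ≤ ‖μ‖ ^ 2 := one_le_pow₀ hμ
  -- The flux strictly increases across the cell and is multiplied by `‖μ‖² ≥ 1`, which is
  -- impossible if it is nonpositive. Positivity is what allows the exponential bound to be divided
  -- by it.
  have hJ : 0 < flux w := by
    by_contra hJ
    nlinarith
  have h5 : Real.exp (-2 * (lam * b₂ * x₂).im) ≤ ‖μ‖ ^ 2 :=
    le_of_mul_le_mul_right (h3.trans h1) hJ
  rw [hθ₂, show -2 * (lam.im * b₂ * x₂) = (2 : ℕ) * (-lam.im * b₂ * x₂) by push_cast; ring,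
    Real.exp_nat_mul] at h5
  exact (pow_le_pow_iff_left₀ (Real.exp_pos _).le (norm_nonneg _) two_ne_zero).1 h5

/-- The transfer matrix of a cell in the basis of right- and left-going waves. -/
theorem exists_cell_matrix (hb₁ : b₁ ≠ 0) (hb₂ : b₂ ≠ 0) (lam : ℂ) : ∃ A B C E : ℂ,
    A * E - B * C = 1 ∧
    ‖B * C‖ = (|b₁ / b₂ - b₂ / b₁| / 2 * ‖Complex.sin (lam * b₂ * x₂)‖) ^ 2 ∧
    ∀ w : ℂ × ℂ,
      (cell b₁ b₂ x₂ lam w).1 + b₁ * (cell b₁ b₂ x₂ lam w).2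
        = A * (w.1 + b₁ * w.2) + B * (w.1 - b₁ * w.2) ∧
      (cell b₁ b₂ x₂ lam w).1 - b₁ * (cell b₁ b₂ x₂ lam w).2
        = C * (w.1 + b₁ * w.2) + E * (w.1 - b₁ * w.2) := by
  have hb₁' : (b₁ : ℂ) ≠ 0 := by exact_mod_cast hb₁
  have hb₂' : (b₂ : ℂ) ≠ 0 := by exact_mod_cast hb₂
  -- These come from passing between the wave bases of the two media. They satisfy `ρ² - σ² = 1`,
  -- and `σ` measures the impedance contrast.
  set ρ : ℂ := (b₁ / b₂ + b₂ / b₁) / 2 with hρ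
  set σ : ℂ := (b₁ / b₂ - b₂ / b₁) / 2 with hσ
  set s := Complex.sin (lam * b₂ * x₂) with hs
  set c := Complex.cos (lam * b₂ * x₂) with hc
  set θ := lam * b₁ * (1 - x₂) with hθ
  have hee : Complex.exp (θ * I) * Complex.exp (-θ * I) = 1 := by
    rw [← Complex.exp_add, ← Complex.exp_zero]
    ring_nf
  have hsc : s ^ 2 + c ^ 2 = 1 := Complex.sin_sq_add_cos_sq _
  have hρσ : ρ ^ 2 - σ ^ 2 = 1 := by
    rw [hρ, hσ]
    field_simp
    ring
  have hBC : Complex.exp (θ * I) * (I * σ * s) * (Complex.exp (-θ * I) * (-(I * σ * s)))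
      = (σ * s) ^ 2 := by
    linear_combination (-(I * σ * s) ^ 2) * hee - (σ * s) ^ 2 * Complex.I_mul_I
  refine ⟨Complex.exp (θ * I) * (c + I * ρ * s), Complex.exp (θ * I) * (I * σ * s),
    Complex.exp (-θ * I) * (-(I * σ * s)), Complex.exp (-θ * I) * (c - I * ρ * s), ?_, ?_,
    fun w ↦ ⟨?_, ?_⟩⟩
  · rw [hBC]
    linear_combination (c ^ 2 - (I * ρ * s) ^ 2) * hee + hsc - (ρ * s) ^ 2 * Complex.I_mul_I
      + s ^ 2 * hρσ
  · rw [hBC, norm_pow, norm_mul, hσ]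
    congr 2
    rw [norm_div, Complex.norm_two]
    congr 1
    rw [← Real.norm_eq_abs, ← Complex.norm_real]
    push_cast
    rfl
  · rw [cell, layer_add_mul hb₁, ← hθ, mul_assoc (Complex.exp _), mul_assoc (Complex.exp _), ← mul_add]
    congr 1
    simp only [layer, ← hs, ← hc, hρ, hσ]
    field_simp
    ring
  · rw [cell, layer_sub_mul hb₁, ← hθ, mul_assoc (Complex.exp _), mul_assoc (Complex.exp _), ← mul_add]
    congr 1
    simp only [layer, ← hs, ← hc, hρ, hσ]
    field_simp
    ring

theorem exists_forall_jostDet_ne_zero (hb₁ : 0 < b₁) (hb₂ : 0 < b₂) (hx₀ : 0 < x₂)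
    (hx₁ : x₂ < 1) {ε : ℝ} (hε : 0 < ε) : ∃ K : ℕ, ∀ k : ℕ, K ≤ k → ∀ lam : ℂ, lam.im ≤ -ε →
      jostDet b₁ b₂ x₂ k lam ≠ 0 := by
  have hb₁' : (b₁ : ℂ) ≠ 0 := by exact_mod_cast hb₁.ne'
  set σ : ℝ := |b₁ / b₂ - b₂ / b₁| / 2 with hσ
  have hdet : ∀ k lam, jostDet b₁ b₂ x₂ k lam = ((cell b₁ b₂ x₂ lam)^[k] (b₁, -1)).1
      - b₁ * ((cell b₁ b₂ x₂ lam)^[k] (b₁, -1)).2 := fun k lam ↦ by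
    rw [jostDet, wronskian, mul_one]
  have hσ0 : 0 ≤ σ := by positivity
  rcases hσ0.eq_or_lt with h0 | h0
  -- Without contrast `B C = 0`. Whichever factor vanishes, the left-going amplitude is multiplied
  -- by `E ≠ 0` in each cell: either the right-going one stays zero or it does not feed back.
  · refine ⟨0, fun k hk lam _ ↦ ?_⟩
    clear hk
    obtain ⟨A, B, C, E, h1, h2, h3⟩ := exists_cell_matrix (x₂ := x₂) hb₁.ne' hb₂.ne' lam
    rw [← hσ, ← h0, zero_mul, zero_pow two_ne_zero, norm_eq_zero] at h2
    rw [h2, sub_zero] at h1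
    have hA : A ≠ 0 := left_ne_zero_of_mul_eq_one h1
    have hE : E ≠ 0 := right_ne_zero_of_mul_eq_one h1
    rcases mul_eq_zero.1 h2 with hB | hC
    · have hp : ∀ n, ((cell b₁ b₂ x₂ lam)^[n] ((b₁ : ℂ), (-1 : ℂ))).1
          + b₁ * ((cell b₁ b₂ x₂ lam)^[n] ((b₁ : ℂ), (-1 : ℂ))).2 = 0 := by
        intro n
        induction n with
        | zero => simp
        | succ n ih => rw [Function.iterate_succ_apply', (h3 _).1, ih, hB]; ring
      rw [hdet]
      induction k with
      | zero => simpa using hb₁'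
      | succ n ih =>
        rw [Function.iterate_succ_apply', (h3 _).2, hp]
        simpa using ⟨hE, ih⟩
    · rw [hdet]
      induction k with
      | zero => simpa using hb₁'
      | succ n ih =>
        rw [Function.iterate_succ_apply', (h3 _).2, hC]
        simpa using ⟨hE, ih⟩
  set κ₀ : ℝ := σ * (ε * b₂ * x₂) with hκ₀
  have hκ₀0 : 0 < κ₀ := by positivity
  have hq : 1 < Real.exp (ε * b₂ * x₂) := Real.one_lt_exp_iff.2 (by positivity)
  -- A zero of `D` will force `‖μ‖^(k - 1) ≤ 1 + 2 / κ ≤ 1 + 2 / κ₀`; this `n` is chosen to violate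
  -- that bound.
  obtain ⟨n, hn⟩ := pow_unbounded_of_one_lt (1 + 2 / κ₀) hq
  refine ⟨n + 1, fun k hk lam hlam hzero ↦ ?_⟩
  have him : lam.im < 0 := by linarith
  obtain ⟨A, B, C, E, h1, h2, h3⟩ := exists_cell_matrix (x₂ := x₂) hb₁.ne' hb₂.ne' lam
  obtain ⟨μ, hμ, hμ1⟩ := exists_root_one_le_norm (A + E)
  set κ : ℝ := σ * ‖Complex.sin (lam * b₂ * x₂)‖ with hκ
  have hmul : ε * b₂ * x₂ ≤ -lam.im * b₂ * x₂ := by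
    gcongr
    linarith
  have hκκ₀ : κ₀ ≤ κ := by
    rw [hκ, hκ₀]
    gcongr
    refine le_trans ?_ (abs_im_le_norm_sin _)
    have hθ₂ : (lam * b₂ * x₂).im = lam.im * b₂ * x₂ := by simp [Complex.mul_im]
    rw [hθ₂]
    refine le_trans (by linarith) (neg_le_abs _)
  have hκ0 : 0 < κ := hκ₀0.trans_le hκκ₀
  have hB : B ≠ 0 := by
    rintro rfl
    rw [zero_mul, norm_zero] at h2
    exact absurd h2.symm (pow_pos hκ0 2).ne'
  -- The eigenvector has amplitudes `(B, μ - A)`, rewritten as a state by `u = (p + m) / 2`, `v = (p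
  -- - m) / (2 b₁)`. It is nonzero because `B ≠ 0`.
  have hμq : Real.exp (ε * b₂ * x₂) ≤ ‖μ‖ := by
    refine (Real.exp_le_exp.2 hmul).trans
      (exp_le_norm_of_cell_eq_smul hb₁ hb₂ hx₀ hx₁ him hμ1
        (w := ((B + (μ - A)) / 2, (B - (μ - A)) / (2 * b₁))) ?_ ?_)
    · intro hw
      have e1 := congrArg Prod.fst hw
      have e2 := congrArg Prod.snd hw
      simp only [Prod.fst_zero, Prod.snd_zero] at e1 e2
      rw [div_eq_zero_iff] at e1 e2
      have e3 := e1.resolve_right two_ne_zero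
      have e4 := e2.resolve_right (mul_ne_zero two_ne_zero hb₁')
      exact hB (by linear_combination (e3 + e4) / 2)
    · obtain ⟨g1, g2⟩ := h3 ((B + (μ - A)) / 2, (B - (μ - A)) / (2 * b₁))
      have e1 : (b₁ : ℂ) * ((B - (μ - A)) / (2 * b₁)) = (B - (μ - A)) / 2 := by field_simp
      simp only [e1] at g1 g2
      generalize cell b₁ b₂ x₂ lam ((B + (μ - A)) / 2, (B - (μ - A)) / (2 * b₁)) = z at *
      ext
      · simp only [Prod.smul_fst, smul_eq_mul]
        linear_combination (g1 + g2) / 2 - hμ / 2 - h1 / 2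
      · simp only [Prod.smul_snd, smul_eq_mul]
        field_simp
        linear_combination g1 - g2 + hμ + h1
  have hbound := mul_norm_pow_le_of_recurrence_eq_zero h1
    (p := fun n ↦ ((cell b₁ b₂ x₂ lam)^[n] ((b₁ : ℂ), (-1 : ℂ))).1
      + b₁ * ((cell b₁ b₂ x₂ lam)^[n] ((b₁ : ℂ), (-1 : ℂ))).2)
    (m := fun n ↦ ((cell b₁ b₂ x₂ lam)^[n] ((b₁ : ℂ), (-1 : ℂ))).1
      - b₁ * ((cell b₁ b₂ x₂ lam)^[n] ((b₁ : ℂ), (-1 : ℂ))).2)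
    (fun n ↦ by rw [Function.iterate_succ_apply']; exact (h3 _).1)
    (fun n ↦ by rw [Function.iterate_succ_apply']; exact (h3 _).2)
    (by simp) (by simpa using hb₁') hμ hμ1 hκ0.le h2.symm (k := k) ((hdet k lam).symm.trans hzero)
  -- One power of `‖μ‖` is divided out to absorb the factor in `2 ‖μ‖`, since `‖μ‖` has no upper
  -- bound uniform in `lam`.
  obtain ⟨j, rfl⟩ : ∃ j, k = j + 1 := ⟨k - 1, by omega⟩
  have hj : n ≤ j := by omega
  have hμ0 : 0 < ‖μ‖ := by linarith
  have h4 : κ * ‖μ‖ ^ j ≤ κ + 2 := by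
    refine le_of_mul_le_mul_right ?_ hμ0
    calc κ * ‖μ‖ ^ j * ‖μ‖ = κ * ‖μ‖ ^ (j + 1) := by ring
      _ ≤ κ + 2 * ‖μ‖ := hbound
      _ ≤ (κ + 2) * ‖μ‖ := by nlinarith
  have h5 : Real.exp (ε * b₂ * x₂) ^ n ≤ ‖μ‖ ^ j :=
    (pow_le_pow_left₀ (Real.exp_pos _).le hμq n).trans (pow_le_pow_right₀ hμ1 hj)
  have h6 : κ * (1 + 2 / κ₀) < κ + 2 := by
    refine lt_of_lt_of_le ?_ h4
    gcongr
    exact hn.trans_le h5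
  have h7 : 2 ≤ κ * (2 / κ₀) := by
    rw [mul_div_assoc', le_div_iff₀ hκ₀0]
    linarith
  linarith

end

end LayeredResonances

end

theorem theorem1 (b₁ b₂ x₂ : ℝ) (hb₁ : 0 < b₁) (hb₂ : 0 < b₂) (hx₀ : 0 < x₂) (hx₁ : x₂ < 1) :
    -- the resolvents have meromorphic continuations, so that the resonances are well defined
    (∀ k : ℕ, 1 ≤ k → ∀ N : ℕ, ∃ T,
      LayeredResonances.IsContinuedResolvent
        (LayeredResonances.truncatedCoeff b₁ b₂ x₂ k) N T) ∧
    -- degenerate band edges and periodicity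
    (b₂ * x₂ = b₁ * (1 - x₂) →
      (∀ m : ℤ, LayeredResonances.IsDegenerateBandEdge b₁ b₂ x₂ (Real.pi * m / (x₂ * b₂))) ∧
      (∀ k : ℕ, 1 ≤ k → ∀ lam : ℂ,
        lam + ((Real.pi / (b₂ * x₂) : ℝ) : ℂ) ∈
            LayeredResonances.Res (LayeredResonances.truncatedCoeff b₁ b₂ x₂ k) ↔
          lam ∈ LayeredResonances.Res (LayeredResonances.truncatedCoeff b₁ b₂ x₂ k))) ∧
    -- the resonances approach the real axis
    (∀ ε : ℝ, 0 < ε → ∃ K : ℕ, ∀ k : ℕ, K ≤ k →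
      ∀ lam ∈ LayeredResonances.Res (LayeredResonances.truncatedCoeff b₁ b₂ x₂ k),
        |lam.im| < ε) := by
  open LayeredResonances in
  refine ⟨fun k _ N ↦ ?_, fun h ↦ ⟨fun m ↦ ?_, fun k _ lam ↦ ?_⟩, fun ε hε ↦ ?_⟩
  · obtain ⟨S, hSd, hS⟩ := exists_differentiable_cutKernel (b₂ := b₂) hb₁ hx₀ hx₁ k N
    exact ⟨_, isContinuedResolvent_smul hb₁ hb₂ hx₀ hx₁ k N hSd hS⟩
  · exact isDegenerateBandEdge_of_balanced hb₁ hb₂ hx₀ h m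
  · rw [mem_Res_iff hb₁ hb₂ hx₀ hx₁, mem_Res_iff hb₁ hb₂ hx₀ hx₁, Complex.add_im,
      Complex.ofReal_im, add_zero, jostDet, jostDet, cell_add_period hb₂ hx₀ h]
  · obtain ⟨K, hK⟩ := exists_forall_jostDet_ne_zero hb₁ hb₂ hx₀ hx₁ hε
    refine ⟨K, fun k hk lam hlam ↦ ?_⟩
    rw [mem_Res_iff hb₁ hb₂ hx₀ hx₁] at hlam
    by_contra hlt
    rw [not_lt, abs_of_neg hlam.1] at hlt
    exact hK k hk lam (by linarith) hlam.2
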